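/- Let $k$ be a field, let $R=k[x_1,\dots,x_n]$ be a polynomial ring with its standard grading ($\deg x_i=1$), let $I_1,I_2\subsetneq R$ be proper homogeneous ideals, and put $S_1=R/I_1$, $S_2=R/I_2$ and $S=S_1\otimes_R S_2$, graded as quotients of $R$. A quotient $A$ of $R$ by a proper homogeneous ideal is called Koszul if its residue field $k=A/A_+$ has a linear minimal graded free resolution over $A$, that is, a minimal graded free resolution $\cdots\to F_2\to F_1\to F_0\to k\to 0$ in which each $F_i$ is a finite direct sum of copies of $A(-i)$. Suppose that $S_1$ and $S_2$ are Tor-independent over $R$, that is, $\operatorname{Tor}^R_i(S_1,S_2)=0$ for all $i>0$. Then $S$ is Koszul if and only if both $S_1$ and $S_2$ are Koszul. -/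

import Mathlib

open MvPolynomial
open scoped TensorProduct

attribute [local instance] MvPolynomial.gradedAlgebra

/-- Two modules `M`, `N` over a commutative ring `R` are Tor-independent if
`Tor_i^R(M, N) = 0` for all `i > 0`. -/
def TorIndependent.{u} (R : Type u) [CommRing R] (M N : Type u) [AddCommGroup M] [Module R M]
    [AddCommGroup N] [Module R N] : Prop :=
  ∀ i : ℕ, 0 < i → CategoryTheory.Limits.IsZero
    (((CategoryTheory.Tor (ModuleCat R) i).obj (ModuleCat.of R M)).obj (ModuleCat.of R N))

section Graded

variable {k A : Type*} [Field k] [CommRing A] [Algebra k A]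

/-- The ideal `A₊` of `A = ⨁ 𝒜 i` generated by the homogeneous elements of positive degree.
If `𝒜 0 = k`, then `A ⧸ A₊` is the residue field `k`, regarded as an `A`-module. -/
def positiveIdeal (𝒜 : ℕ → Submodule k A) : Ideal A :=
  Ideal.span {a | ∃ i, 0 < i ∧ a ∈ 𝒜 i}

/-- A graded free resolution
`⋯ → F₂ → F₁ → F₀ → A ⧸ A₊ → 0` of the residue field `A ⧸ A₊` over `A = ⨁ 𝒜 i`,
in which `F i = ⨁_b A(-deg i b)` has a finite homogeneous basis indexed by `Fin (rank i)`, and in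
which all maps are `A`-linear and preserve the internal degree. -/
structure GradedFreeResolution (𝒜 : ℕ → Submodule k A) where
  /-- The rank of `F i`. -/
  rank : ℕ → ℕ
  /-- The internal degrees of the basis elements of `F i`. -/
  deg : ∀ i, Fin (rank i) → ℕ
  /-- The differential `F (i + 1) → F i`. -/
  d : ∀ i, (Fin (rank (i + 1)) → A) →ₗ[A] (Fin (rank i) → A)
  /-- The augmentation `F 0 → A ⧸ A₊`. -/
  aug : (Fin (rank 0) → A) →ₗ[A] (A ⧸ positiveIdeal 𝒜)
  /-- The coefficient of `d e_b` at `e_c` is homogeneous of degree `deg b - deg c`. -/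
  d_homogeneous : ∀ i b c m, deg (i + 1) b = deg i c + m → d i (Pi.single b 1) c ∈ 𝒜 m
  /-- The coefficient of `d e_b` at `e_c` is zero if `deg b - deg c` is negative. -/
  d_eq_zero : ∀ i b c, deg (i + 1) b < deg i c → d i (Pi.single b 1) c = 0
  /-- The residue field is concentrated in degree zero. -/
  aug_homogeneous : ∀ b, deg 0 b ≠ 0 → aug (Pi.single b 1) = 0
  aug_surjective : Function.Surjective aug
  exact_zero : Function.Exact (d 0) aug
  exact_succ : ∀ i, Function.Exact (d (i + 1)) (d i)

/-- The resolution is minimal: the image of `F (i + 1) → F i` lies in `A₊ F i`. -/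
def GradedFreeResolution.IsMinimal {𝒜 : ℕ → Submodule k A} (F : GradedFreeResolution 𝒜) : Prop :=
  ∀ i x c, F.d i x c ∈ positiveIdeal 𝒜

/-- The resolution is linear: `F i` is generated in internal degree `i`. -/
def GradedFreeResolution.IsLinear {𝒜 : ℕ → Submodule k A} (F : GradedFreeResolution 𝒜) : Prop :=
  ∀ i b, F.deg i b = i

/-- The graded algebra `A = ⨁ 𝒜 i` is Koszul if its residue field has a linear minimal
graded free resolution over `A`. -/
def IsKoszul (𝒜 : ℕ → Submodule k A) : Prop :=
  ∃ F : GradedFreeResolution 𝒜, F.IsMinimal ∧ F.IsLinear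

end Graded

/-- The internal grading that an algebra `S` over `R = k[x₁, …, xₙ]` acquires from the standard
grading of `R`: the degree `d` part is the image of the forms of degree `d`. It is used for
algebras whose structure map from `R` is surjective with homogeneous kernel. -/
noncomputable def gradingFromPolynomialRing (k : Type*) [Field k] (n : ℕ) (S : Type*) [CommRing S] [Algebra k S]
    [Algebra (MvPolynomial (Fin n) k) S] [IsScalarTower k (MvPolynomial (Fin n) k) S] (d : ℕ) :
    Submodule k S :=
  (homogeneousSubmodule (Fin n) k d).map
    (IsScalarTower.toAlgHom k (MvPolynomial (Fin n) k) S).toLinearMap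

/-! Put Q = k[x, z], J = I₁(x) + I₂(z) and D = (x₁ - z₁, …, xₙ - zₙ). Then Q/J = S₁ ⊗ₖ S₂ and Q/(J +
D) = S. So two things suffice: S₁ ⊗ₖ S₂ is Koszul exactly when both factors are
(`isKoszul_tensorProduct_iff`), and dividing Q/J by the diagonal forms does not affect Koszulness
(`isKoszul_quotient_iff_sup_span`).

For the second, the diagonal forms must be a regular sequence on Q/J, and only Tor₁ is needed. Its
vanishing gives I₁ ∩ I₂ = I₁I₂ (`inf_le_mul_of_torIndependent`). A computation on the diagonal turns
this into J ∩ D = JD (`sumIdeal_inf_diagonalIdeal_le`), that is, Tor₁(Q/J, Q/D) = 0 over Q. As the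
forms are regular on Q, a graded rigidity argument (`inf_le_mul_of_regular`,
`mem_sup_of_mul_mem_sup`) makes them regular on Q/J.

Both points rest on one change of rings, `isLinearUpTo_iff_of_surjective`: if the kernel of a graded
surjection C → A is generated by linear forms and has a linear resolution over C, then an A-module
is linear over C exactly when it is linear over A. For a regular linear form the kernel is C(-1).
For A ⊗ₖ B → B it is A₊ ⊗ B, which is linear by flat base change once A is Koszul; and A is Koszul
whenever A ⊗ₖ B is, being a retract.

Koszulness is recast in terms of iterated syzygies: the irrelevant ideal and all its syzygies, each
reindexed to start in degree zero, are generated there (`isKoszul_iff_isLinearUpTo`). Short exact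
sequences of such modules induce short exact sequences of syzygies, so permanence properties follow
by induction on the number of steps. -/

/-! ### Subspaces `P ⊗ V` of `A ⊗ V` over a field -/

section TensorPiece

variable {k A A' V W U : Type*} [Field k] [CommRing A] [Algebra k A] [CommRing A'] [Algebra k A']
  [AddCommGroup V] [Module k V] [AddCommGroup W] [Module k W] [AddCommGroup U] [Module k U]

/-- The image of `P ⊗ V` in `A ⊗ V`. -/
def tensorPiece (P : Submodule k A) (V : Type*) [AddCommGroup V] [Module k V] :
    Submodule k (A ⊗[k] V) :=
  Submodule.map₂ (TensorProduct.mk k A V) P ⊤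

lemma tmul_mem_tensorPiece {P : Submodule k A} {a : A} (ha : a ∈ P) (v : V) :
    a ⊗ₜ[k] v ∈ tensorPiece P V :=
  Submodule.apply_mem_map₂ (TensorProduct.mk k A V) ha (Submodule.mem_top (x := v))

lemma tensorPiece_le {P : Submodule k A} {N : Submodule k (A ⊗[k] V)}
    (h : ∀ a ∈ P, ∀ v : V, a ⊗ₜ[k] v ∈ N) : tensorPiece P V ≤ N :=
  Submodule.map₂_le.2 fun a ha v _ => h a ha v

lemma tensorPiece_eq_range (P : Submodule k A) :
    tensorPiece P V = LinearMap.range (P.subtype.rTensor V) := by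
  rw [LinearMap.rTensor, TensorProduct.range_map]
  simp [tensorPiece]

lemma apply_mem_of_mem_tensorPiece {N : Type*} [AddCommGroup N] [Module k N] {P : Submodule k A}
    {L : A ⊗[k] V →ₗ[k] N} {S : Submodule k N} (h : ∀ a ∈ P, ∀ v : V, L (a ⊗ₜ[k] v) ∈ S)
    {x : A ⊗[k] V} (hx : x ∈ tensorPiece P V) : L x ∈ S :=
  tensorPiece_le (N := S.comap L) h hx

lemma exists_mem_tensorPiece_map_eq {P : Submodule k A} {P' : Submodule k A'} {φ : A →ₗ[k] A'}
    {f : V →ₗ[k] W} (hφ : ∀ a' ∈ P', ∃ a ∈ P, φ a = a') (hf : Function.Surjective f)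
    {y : A' ⊗[k] W} (hy : y ∈ tensorPiece P' W) :
    ∃ x ∈ tensorPiece P V, TensorProduct.map φ f x = y := by
  have : tensorPiece P' W ≤ (tensorPiece P V).map (TensorProduct.map φ f) := by
    refine tensorPiece_le fun a' ha' w => ?_
    obtain ⟨a, ha, rfl⟩ := hφ a' ha'
    obtain ⟨v, rfl⟩ := hf w
    exact ⟨a ⊗ₜ v, tmul_mem_tensorPiece ha v, by simp⟩
  exact this hy

/-- Everything is flat over `k`: `P ⊗ W` embeds in `A ⊗ W`, and tensoring with `P` keeps the
sequence exact. Hence preimages can be chosen in the same graded piece. -/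
lemma exists_mem_tensorPiece_baseChange_eq {P : Submodule k A} {f : U →ₗ[k] V} {g : V →ₗ[k] W}
    (hfg : Function.Exact f g) {x : A ⊗[k] V} (hx : x ∈ tensorPiece P V)
    (h0 : g.baseChange A x = 0) : ∃ y ∈ tensorPiece P U, f.baseChange A y = x := by
  rw [tensorPiece_eq_range] at hx
  obtain ⟨z, rfl⟩ := hx
  have hinj : Function.Injective (P.subtype.rTensor W) :=
    Module.Flat.rTensor_preserves_injective_linearMap _ P.injective_subtype
  have hc : ∀ z, g.baseChange A (P.subtype.rTensor V z) = P.subtype.rTensor W (g.lTensor P z) := by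
    intro z
    induction z using TensorProduct.induction_on with
    | zero => simp
    | tmul a v => simp
    | add a b ha hb => simp only [map_add, ha, hb]
  have hc' : ∀ z, f.baseChange A (P.subtype.rTensor U z) = P.subtype.rTensor V (f.lTensor P z) := by
    intro z
    induction z using TensorProduct.induction_on with
    | zero => simp
    | tmul a v => simp
    | add a b ha hb => simp only [map_add, ha, hb]
  rw [hc] at h0
  have h1 : g.lTensor P z = 0 := hinj (by rw [h0, map_zero])
  obtain ⟨w, rfl⟩ := (Module.Flat.lTensor_exact P hfg z).1 h1
  exact ⟨P.subtype.rTensor U w, by rw [tensorPiece_eq_range]; exact ⟨w, rfl⟩, hc' w⟩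

/-- By flatness of `V`, tensoring the kernel of `φ` restricted to `P` gives the kernel of the
tensored map. -/
lemma mem_tensorPiece_inf_ker {P : Submodule k A} {φ : A →ₗ[k] A'} {x : A ⊗[k] V}
    (hx : x ∈ tensorPiece P V) (h0 : φ.rTensor V x = 0) :
    x ∈ tensorPiece (P ⊓ LinearMap.ker φ) V := by
  rw [tensorPiece_eq_range] at hx
  obtain ⟨z, rfl⟩ := hx
  have hex : Function.Exact (LinearMap.ker (φ ∘ₗ P.subtype)).subtype (φ ∘ₗ P.subtype) :=
    LinearMap.exact_subtype_ker_map (φ ∘ₗ P.subtype)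
  have h1 : (φ ∘ₗ P.subtype).rTensor V z = 0 := by
    rw [LinearMap.rTensor_comp]; exact h0
  obtain ⟨w, rfl⟩ :=
    (Module.Flat.rTensor_exact (R := k) (N := LinearMap.ker (φ ∘ₗ P.subtype)) V hex z).1 h1
  clear h0 h1
  induction w using TensorProduct.induction_on with
  | zero => simp
  | tmul a v =>
    exact tmul_mem_tensorPiece (P := P ⊓ LinearMap.ker φ) (a := (a : P)) ⟨a.1.2, a.2⟩ v
  | add a b ha hb => simp only [map_add]; exact add_mem ha hb

lemma smul_mem_tensorPiece {P Q R : Submodule k A} (h : ∀ a ∈ P, ∀ b ∈ Q, a * b ∈ R) {a : A}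
    (ha : a ∈ P) {x : A ⊗[k] V} (hx : x ∈ tensorPiece Q V) : a • x ∈ tensorPiece R V := by
  refine apply_mem_of_mem_tensorPiece (L := (LinearMap.lsmul A (A ⊗[k] V) a).restrictScalars k)
    (fun b hb v => ?_) hx
  simpa [TensorProduct.smul_tmul'] using tmul_mem_tensorPiece (h a ha b hb) v

lemma baseChange_injective {f : U →ₗ[k] V} (hf : Function.Injective f) :
    Function.Injective (f.baseChange A) :=
  Module.Flat.lTensor_preserves_injective_linearMap (M := A) f hf

end TensorPiece

/-! ### Modules with linear resolutions, via iterated syzygies -/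

section Linear

universe u

variable {k : Type u} [Field k]

/-- Multiplication `A ⊗ V → M` for a `k`-subspace `V` of an `A`-module `M`. -/
noncomputable def spanMap (A : Type*) {M : Type*} [CommRing A] [Algebra k A] [AddCommGroup M]
    [Module k M] [Module A M] [IsScalarTower k A M] (V : Submodule k M) : A ⊗[k] V →ₗ[A] M :=
  V.subtype.liftBaseChange A

@[simp] lemma spanMap_tmul {A M : Type*} [CommRing A] [Algebra k A] [AddCommGroup M]
    [Module k M] [Module A M] [IsScalarTower k A M] (V : Submodule k M) (a : A) (v : V) :
    spanMap A V (a ⊗ₜ[k] v) = a • (v : M) := by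
  simp [spanMap]

/-- The graded pieces, shifted by one, of the first syzygy of a graded module `ℳ` generated in
degree zero. -/
noncomputable def syzygy {A M : Type*} [CommRing A] [Algebra k A] (𝒜 : ℕ → Submodule k A)
    [AddCommGroup M] [Module k M] [Module A M] [IsScalarTower k A M] (ℳ : ℕ → Submodule k M)
    (j : ℕ) : Submodule k (A ⊗[k] ℳ 0) :=
  tensorPiece (𝒜 (j + 1)) (ℳ 0) ⊓ (LinearMap.ker (spanMap A (ℳ 0))).restrictScalars k

/-- The graded module with pieces `ℳ j` is finitely generated in degree zero. -/
structure GeneratedInDegreeZero {A M : Type*} [CommRing A] [Algebra k A] (𝒜 : ℕ → Submodule k A)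
    [AddCommGroup M] [Module k M] [Module A M] [IsScalarTower k A M] (ℳ : ℕ → Submodule k M) :
    Prop where
  finite : FiniteDimensional k (ℳ 0)
  smul_mem : ∀ j, ∀ a ∈ 𝒜 j, ∀ m ∈ ℳ 0, a • m ∈ ℳ j
  exists_eq : ∀ j, ∀ m ∈ ℳ j, ∃ x ∈ tensorPiece (𝒜 j) (ℳ 0), spanMap A (ℳ 0) x = m

/-- The first `n` steps of the minimal resolution of the graded module with pieces `ℳ j` are
linear. -/
def IsLinearUpTo {A : Type u} [CommRing A] [Algebra k A] (𝒜 : ℕ → Submodule k A) :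
    ℕ → ∀ (M : Type u) [AddCommGroup M] [Module k M] [Module A M] [IsScalarTower k A M],
      (ℕ → Submodule k M) → Prop
  | 0, _, _, _, _, _, ℳ => GeneratedInDegreeZero 𝒜 ℳ
  | n + 1, _, _, _, _, _, ℳ =>
    GeneratedInDegreeZero 𝒜 ℳ ∧ IsLinearUpTo 𝒜 n (A ⊗[k] ℳ 0) (syzygy 𝒜 ℳ)

section

variable {A : Type u} [CommRing A] [Algebra k A] {𝒜 : ℕ → Submodule k A}
  {M : Type u} [AddCommGroup M] [Module k M] [Module A M] [IsScalarTower k A M]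
  {ℳ : ℕ → Submodule k M}
  {M' : Type u} [AddCommGroup M'] [Module k M'] [Module A M'] [IsScalarTower k A M']
  {ℳ' : ℕ → Submodule k M'}
  {M'' : Type u} [AddCommGroup M''] [Module k M''] [Module A M''] [IsScalarTower k A M'']
  {ℳ'' : ℕ → Submodule k M''}

lemma IsLinearUpTo.generated {n : ℕ} (h : IsLinearUpTo 𝒜 n M ℳ) : GeneratedInDegreeZero 𝒜 ℳ := by
  cases n with
  | zero => exact h
  | succ n => exact h.1

lemma spanMap_mem (h : ∀ j, ∀ a ∈ 𝒜 j, ∀ m ∈ ℳ 0, a • m ∈ ℳ j) {j : ℕ} {x : A ⊗[k] ℳ 0}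
    (hx : x ∈ tensorPiece (𝒜 j) (ℳ 0)) : spanMap A (ℳ 0) x ∈ ℳ j :=
  apply_mem_of_mem_tensorPiece (L := (spanMap A (ℳ 0)).restrictScalars k)
    (fun a ha v => by simpa using h j a ha v v.2) hx

lemma smul_syzygy_mem [SetLike.GradedMonoid 𝒜] (ℳ : ℕ → Submodule k M) (j : ℕ) :
    ∀ a ∈ 𝒜 j, ∀ x ∈ syzygy 𝒜 ℳ 0, a • x ∈ syzygy 𝒜 ℳ j := by
  intro a ha x hx
  refine ⟨smul_mem_tensorPiece (fun a ha b hb => ?_) ha hx.1, ?_⟩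
  · exact SetLike.GradedMul.mul_mem ha hb
  · have : spanMap A (ℳ 0) x = 0 := hx.2
    simp [this]

/-- A degreewise short exact sequence of graded modules. -/
structure GradedShortExact (𝒜 : ℕ → Submodule k A) (ℳ' : ℕ → Submodule k M')
    (ℳ : ℕ → Submodule k M) (ℳ'' : ℕ → Submodule k M'') (f : M' →ₗ[A] M) (g : M →ₗ[A] M'') :
    Prop where
  smul_mem : ∀ j, ∀ a ∈ 𝒜 j, ∀ m ∈ ℳ 0, a • m ∈ ℳ j
  map_left : ∀ j, ∀ m ∈ ℳ' j, f m ∈ ℳ j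
  map_right : ∀ j, ∀ m ∈ ℳ j, g m ∈ ℳ'' j
  injective : ∀ j, ∀ m ∈ ℳ' j, f m = 0 → m = 0
  comp : ∀ j, ∀ m ∈ ℳ' j, g (f m) = 0
  exact : ∀ j, ∀ m ∈ ℳ j, g m = 0 → ∃ m' ∈ ℳ' j, f m' = m
  surjective : ∀ j, ∀ m ∈ ℳ'' j, ∃ m' ∈ ℳ j, g m' = m

namespace GradedShortExact

variable {f : M' →ₗ[A] M} {g : M →ₗ[A] M''} (h : GradedShortExact 𝒜 ℳ' ℳ ℳ'' f g)
include h

/-- The restriction of `f` to degree zero. -/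
def left₀ : ℳ' 0 →ₗ[k] ℳ 0 := (f.restrictScalars k).restrict (h.map_left 0)

/-- The restriction of `g` to degree zero. -/
def right₀ : ℳ 0 →ₗ[k] ℳ'' 0 := (g.restrictScalars k).restrict (h.map_right 0)

omit [IsScalarTower k A M''] in
lemma left₀_injective : Function.Injective h.left₀ :=
  (injective_iff_map_eq_zero _).2 fun x hx =>
    Subtype.ext (h.injective 0 x x.2 (congrArg Subtype.val hx))

omit [IsScalarTower k A M'] in
lemma right₀_surjective : Function.Surjective h.right₀ := fun y => by
  obtain ⟨x, hx, hxy⟩ := h.surjective 0 y y.2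
  exact ⟨⟨x, hx⟩, Subtype.ext hxy⟩

lemma exact₀ : Function.Exact h.left₀ h.right₀ := fun y => by
  constructor
  · intro hy
    obtain ⟨x, hx, hxy⟩ := h.exact 0 y y.2 (congrArg Subtype.val hy)
    exact ⟨⟨x, hx⟩, Subtype.ext hxy⟩
  · rintro ⟨x, rfl⟩
    exact Subtype.ext (h.comp 0 x x.2)

omit [IsScalarTower k A M''] in
lemma spanMap_left (x : A ⊗[k] ℳ' 0) :
    spanMap A (ℳ 0) (h.left₀.baseChange A x) = f (spanMap A (ℳ' 0) x) := by
  induction x using TensorProduct.induction_on with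
  | zero => simp
  | tmul a v => simp; rfl
  | add a b ha hb => simp only [map_add, ha, hb]

omit [IsScalarTower k A M'] in
lemma spanMap_right (x : A ⊗[k] ℳ 0) :
    spanMap A (ℳ'' 0) (h.right₀.baseChange A x) = g (spanMap A (ℳ 0) x) := by
  induction x using TensorProduct.induction_on with
  | zero => simp
  | tmul a v => simp; rfl
  | add a b ha hb => simp only [map_add, ha, hb]

/-- This is the snake lemma for the free covers, which form a short exact sequence because the
degree zero parts do. Generation of the left module is what makes the last map surjective: a lift of
a syzygy is off by an element of `M'`, which is corrected from the cover of `M'`. -/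
lemma syzygy [SetLike.GradedMonoid 𝒜] (h' : GeneratedInDegreeZero 𝒜 ℳ') :
    GradedShortExact 𝒜 (syzygy 𝒜 ℳ') (_root_.syzygy 𝒜 ℳ) (_root_.syzygy 𝒜 ℳ'')
      (h.left₀.baseChange A) (h.right₀.baseChange A) where
  smul_mem := smul_syzygy_mem ℳ
  map_left j x hx := by
    refine ⟨apply_mem_of_mem_tensorPiece (L := (h.left₀.baseChange A).restrictScalars k)
      (fun a ha v => by simpa using tmul_mem_tensorPiece ha _) hx.1, ?_⟩
    have : spanMap A (ℳ' 0) x = 0 := hx.2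
    change spanMap A (ℳ 0) _ = 0
    rw [h.spanMap_left, this, map_zero]
  map_right j x hx := by
    refine ⟨apply_mem_of_mem_tensorPiece (L := (h.right₀.baseChange A).restrictScalars k)
      (fun a ha v => by simpa using tmul_mem_tensorPiece ha _) hx.1, ?_⟩
    have : spanMap A (ℳ 0) x = 0 := hx.2
    change spanMap A (ℳ'' 0) _ = 0
    rw [h.spanMap_right, this, map_zero]
  injective j x _ h0 := baseChange_injective h.left₀_injective (by rw [h0, map_zero])
  comp j x _ := by
    have : h.right₀ ∘ₗ h.left₀ = 0 := h.exact₀.linearMap_comp_eq_zero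
    rw [← LinearMap.comp_apply, ← LinearMap.baseChange_comp, this]
    simp
  exact j x hx h0 := by
    obtain ⟨y, hy, rfl⟩ := exists_mem_tensorPiece_baseChange_eq h.exact₀ hx.1 h0
    refine ⟨y, ⟨hy, ?_⟩, rfl⟩
    have h2 : spanMap A (ℳ 0) (h.left₀.baseChange A y) = 0 := hx.2
    rw [h.spanMap_left] at h2
    exact h.injective (j + 1) _ (spanMap_mem h'.smul_mem hy) h2
  surjective j y hy := by
    obtain ⟨x, hx, rfl⟩ := exists_mem_tensorPiece_map_eq (P := 𝒜 (j + 1)) (φ := LinearMap.id)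
      (fun a ha => ⟨a, ha, rfl⟩) h.right₀_surjective hy.1
    have hx2 : spanMap A (ℳ'' 0) (h.right₀.baseChange A x) = 0 := hy.2
    rw [h.spanMap_right] at hx2
    obtain ⟨m', hm', e⟩ := h.exact (j + 1) _ (spanMap_mem h.smul_mem hx) hx2
    obtain ⟨z, hz, rfl⟩ := h'.exists_eq _ m' hm'
    refine ⟨x - h.left₀.baseChange A z, ⟨sub_mem hx ?_, ?_⟩, ?_⟩
    · exact apply_mem_of_mem_tensorPiece (L := (h.left₀.baseChange A).restrictScalars k)
        (fun a ha v => by simpa using tmul_mem_tensorPiece ha _) hz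
    · change spanMap A (ℳ 0) _ = 0
      rw [map_sub, h.spanMap_left, e, sub_self]
    · have : h.right₀ ∘ₗ h.left₀ = 0 := h.exact₀.linearMap_comp_eq_zero
      have h3 : h.right₀.baseChange A (h.left₀.baseChange A z) = 0 := by
        rw [← LinearMap.comp_apply, ← LinearMap.baseChange_comp, this]
        simp
      rw [map_sub, h3, sub_zero]
      rfl

lemma generated_middle (h' : GeneratedInDegreeZero 𝒜 ℳ') (h'' : GeneratedInDegreeZero 𝒜 ℳ'') :
    GeneratedInDegreeZero 𝒜 ℳ where
  finite := by
    have := h'.finite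
    have := h''.finite
    exact Module.Finite.of_exact h.exact₀ h.right₀_surjective
  smul_mem := h.smul_mem
  exists_eq j m hm := by
    obtain ⟨y, hy, e⟩ := h''.exists_eq j _ (h.map_right j m hm)
    obtain ⟨x, hx, rfl⟩ := exists_mem_tensorPiece_map_eq (P := 𝒜 j) (φ := LinearMap.id)
      (fun a ha => ⟨a, ha, rfl⟩) h.right₀_surjective hy
    change spanMap A (ℳ'' 0) (h.right₀.baseChange A x) = _ at e
    rw [h.spanMap_right] at e
    obtain ⟨m', hm', e'⟩ := h.exact j (m - spanMap A (ℳ 0) x)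
      (sub_mem hm (spanMap_mem h.smul_mem hx)) (by rw [map_sub, e, sub_self])
    obtain ⟨z, hz, rfl⟩ := h'.exists_eq j m' hm'
    refine ⟨x + h.left₀.baseChange A z, add_mem hx ?_, ?_⟩
    · exact apply_mem_of_mem_tensorPiece (L := (h.left₀.baseChange A).restrictScalars k)
        (fun a ha v => by simpa using tmul_mem_tensorPiece ha _) hz
    · rw [map_add, h.spanMap_left, e', add_sub_cancel]

omit [IsScalarTower k A M'] in
lemma generated_right (hM : GeneratedInDegreeZero 𝒜 ℳ) :
    GeneratedInDegreeZero 𝒜 ℳ'' where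
  finite := by
    have := hM.finite
    exact Module.Finite.of_surjective _ h.right₀_surjective
  smul_mem j a ha m hm := by
    obtain ⟨m₁, hm₁, rfl⟩ := h.surjective 0 m hm
    rw [← map_smul]
    exact h.map_right _ _ (hM.smul_mem j a ha m₁ hm₁)
  exists_eq j m hm := by
    obtain ⟨m₁, hm₁, rfl⟩ := h.surjective j m hm
    obtain ⟨x, hx, rfl⟩ := hM.exists_eq j m₁ hm₁
    exact ⟨h.right₀.baseChange A x,
      apply_mem_of_mem_tensorPiece (L := (h.right₀.baseChange A).restrictScalars k)
        (fun a ha v => by simpa using tmul_mem_tensorPiece ha _) hx, h.spanMap_right x⟩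

end GradedShortExact

lemma IsLinearUpTo.of_shortExact_middle [SetLike.GradedMonoid 𝒜] {n : ℕ} {f : M' →ₗ[A] M}
    {g : M →ₗ[A] M''} (h : GradedShortExact 𝒜 ℳ' ℳ ℳ'' f g) (h' : IsLinearUpTo 𝒜 n M' ℳ')
    (h'' : IsLinearUpTo 𝒜 n M'' ℳ'') : IsLinearUpTo 𝒜 n M ℳ := by
  induction n generalizing M M' M'' with
  | zero => exact h.generated_middle h' h''
  | succ n ih => exact ⟨h.generated_middle h'.1 h''.1, ih (h.syzygy h'.1) h'.2 h''.2⟩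

/-- No step is lost on the right: all three modules start in the same degree, so the syzygies again
form a short exact sequence of the same type, and generation passes to quotients. -/
lemma IsLinearUpTo.of_shortExact_right [SetLike.GradedMonoid 𝒜] {n : ℕ} {f : M' →ₗ[A] M}
    {g : M →ₗ[A] M''} (h : GradedShortExact 𝒜 ℳ' ℳ ℳ'' f g) (h' : IsLinearUpTo 𝒜 n M' ℳ')
    (hM : IsLinearUpTo 𝒜 n M ℳ) : IsLinearUpTo 𝒜 n M'' ℳ'' := by
  induction n generalizing M M' M'' with
  | zero => exact h.generated_right hM
  | succ n ih => exact ⟨h.generated_right hM.1, ih (h.syzygy h'.1) h'.2 hM.2⟩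

lemma IsLinearUpTo.of_eq_bot (n : ℕ) (h : ∀ j, ℳ j = ⊥) : IsLinearUpTo 𝒜 n M ℳ := by
  have gen : ∀ (M : Type u) [AddCommGroup M] [Module k M] [Module A M] [IsScalarTower k A M]
      (ℳ : ℕ → Submodule k M), (∀ j, ℳ j = ⊥) → GeneratedInDegreeZero 𝒜 ℳ := by
    intro M _ _ _ _ ℳ h
    refine ⟨?_, ?_, ?_⟩
    · rw [h 0]; infer_instance
    · intro j a _ m hm
      rw [h 0, Submodule.mem_bot] at hm
      simp [hm]
    · intro j m hm
      rw [h j, Submodule.mem_bot] at hm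
      exact ⟨0, zero_mem _, by simp [hm]⟩
  induction n generalizing M with
  | zero => exact gen M ℳ h
  | succ n ih =>
    refine ⟨gen M ℳ h, ih fun j => ?_⟩
    have : Subsingleton (ℳ 0) := by rw [h 0]; infer_instance
    exact Subsingleton.elim _ _

/-- Linearity only depends on the pieces. -/
lemma IsLinearUpTo.of_bijOn [SetLike.GradedMonoid 𝒜] {n : ℕ} (h : IsLinearUpTo 𝒜 n M ℳ)
    (g : M →ₗ[A] M'') (hg : ∀ j, ∀ m ∈ ℳ j, g m ∈ ℳ'' j)
    (hinj : ∀ j, ∀ m ∈ ℳ j, g m = 0 → m = 0)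
    (hsurj : ∀ j, ∀ m ∈ ℳ'' j, ∃ m' ∈ ℳ j, g m' = m) : IsLinearUpTo 𝒜 n M'' ℳ'' := by
  -- A degreewise bijection is a short exact sequence whose left term has zero pieces; the ambient
  -- module of that term is irrelevant.
  refine IsLinearUpTo.of_shortExact_right (M' := M) (ℳ' := fun _ => ⊥) (f := 0) (g := g)
    ⟨h.generated.smul_mem, ?_, hg, ?_, ?_, ?_, hsurj⟩ (IsLinearUpTo.of_eq_bot n fun _ => rfl) h
  · intro j m _; simp
  · intro j m hm _; simpa using hm
  · intro j m _; simp
  · intro j m hm h0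
    exact ⟨0, zero_mem _, by simp [hinj j m hm h0]⟩

/-- Induction on `r` along the sequence 0 → M → M^(r+1) → M^r → 0, with the zeroth coordinate as
subobject. -/
lemma IsLinearUpTo.pi [SetLike.GradedMonoid 𝒜] {n : ℕ} (h : IsLinearUpTo 𝒜 n M ℳ) (r : ℕ) :
    IsLinearUpTo 𝒜 n (Fin r → M) fun j => Submodule.pi Set.univ fun _ => ℳ j := by
  induction r with
  | zero => exact .of_eq_bot n fun j => Subsingleton.elim _ _
  | succ r ih =>
    refine .of_shortExact_middle (f := LinearMap.single A (fun _ : Fin (r + 1) => M) 0)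
      (g := LinearMap.funLeft A M Fin.succ) ⟨?_, ?_, ?_, ?_, ?_, ?_, ?_⟩ h ih
    · intro j a ha m hm i hi
      exact h.generated.smul_mem j a ha _ (hm i hi)
    · intro j m hm i _
      refine Fin.cases ?_ (fun i => ?_) i
      · simpa using hm
      · simp
    · intro j m hm i _
      exact hm i.succ trivial
    · intro j m _ h0
      simpa using congrFun h0 0
    · intro j m _
      ext i
      simp [LinearMap.funLeft_apply]
    · intro j m hm h0
      refine ⟨m 0, hm 0 trivial, ?_⟩
      ext i
      refine Fin.cases ?_ (fun i => ?_) i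
      · simp
      · simpa [LinearMap.funLeft_apply] using (congrFun h0 i).symm
    · intro j m hm
      refine ⟨Fin.cons 0 m, fun i _ => ?_, ?_⟩
      · refine Fin.cases ?_ (fun i => ?_) i
        · simp
        · simpa using hm i trivial
      · ext i
        simp [LinearMap.funLeft_apply]

lemma mem_tensorPiece_iff {V ι : Type*} [AddCommGroup V] [Module k V] [Fintype ι]
    (b : Module.Basis ι k V) (P : Submodule k A) (x : A ⊗[k] V) :
    x ∈ tensorPiece P V ↔ ∀ i, (b.baseChange A).repr x i ∈ P := by
  constructor
  · intro hx i
    let L : A ⊗[k] V →ₗ[k] A :=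
      (Finsupp.lapply i ∘ₗ (b.baseChange A).repr.toLinearMap).restrictScalars k
    refine apply_mem_of_mem_tensorPiece (L := L) (fun a ha v => ?_) hx
    have : L (a ⊗ₜ v) = b.repr v i • a := Module.Basis.baseChange_repr_tmul _ _ _ _ _
    rw [this]
    exact P.smul_mem _ ha
  · intro h
    rw [← (b.baseChange A).sum_repr x]
    refine sum_mem fun i _ => ?_
    rw [Module.Basis.baseChange_apply, TensorProduct.smul_tmul', smul_eq_mul, mul_one]
    exact tmul_mem_tensorPiece (h i) _

lemma IsLinearUpTo.tensor [SetLike.GradedMonoid 𝒜] {n : ℕ} {𝒥 : ℕ → Submodule k A}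
    (h : IsLinearUpTo 𝒜 n A 𝒥) (V : Type u) [AddCommGroup V] [Module k V]
    [FiniteDimensional k V] : IsLinearUpTo 𝒜 n (A ⊗[k] V) fun j => tensorPiece (𝒥 j) V := by
  let b := Module.finBasis k V
  refine (h.pi (Module.finrank k V)).of_bijOn (b.baseChange A).equivFun.symm.toLinearMap ?_ ?_ ?_
  · intro j m hm
    rw [mem_tensorPiece_iff b]
    intro i
    have := congrFun ((b.baseChange A).equivFun.apply_symm_apply m) i
    rw [Module.Basis.equivFun_apply] at this
    simp only [LinearEquiv.coe_coe]
    rw [this]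
    exact hm i trivial
  · intro j m _ h0
    exact (LinearEquiv.map_eq_zero_iff _).1 h0
  · intro j m hm
    rw [mem_tensorPiece_iff b] at hm
    exact ⟨(b.baseChange A).equivFun m, fun i _ => by simpa using hm i,
      (b.baseChange A).equivFun.symm_apply_apply m⟩

/-- A connected graded algebra is linear as a module over itself. -/
lemma IsLinearUpTo.self [SetLike.GradedMonoid 𝒜] (h0 : 𝒜 0 = 1) (n : ℕ) :
    IsLinearUpTo 𝒜 n A 𝒜 := by
  have one : (1 : A) ∈ 𝒜 0 := SetLike.GradedOne.one_mem
  -- Since `𝒜 0` is spanned by 1, the free cover of `A` is an isomorphism, so the first syzygy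
  -- vanishes.
  have key : ∀ x : A ⊗[k] 𝒜 0, x = spanMap A (𝒜 0) x ⊗ₜ ⟨1, one⟩ := by
    intro x
    induction x using TensorProduct.induction_on with
    | zero => simp
    | tmul a v =>
      obtain ⟨v, hv⟩ := v
      obtain ⟨c, rfl⟩ := Submodule.mem_one.1 (h0 ▸ hv)
      have : (⟨algebraMap k A c, hv⟩ : 𝒜 0) = c • ⟨1, one⟩ :=
        Subtype.ext (by simp [Algebra.algebraMap_eq_smul_one])
      rw [this, spanMap_tmul, ← TensorProduct.smul_tmul]
      simp
    | add a b ha hb => rw [map_add, TensorProduct.add_tmul, ← ha, ← hb]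
  have gen : GeneratedInDegreeZero 𝒜 𝒜 := by
    refine ⟨?_, ?_, ?_⟩
    · rw [h0, Submodule.one_eq_span]; infer_instance
    · intro j a ha m hm
      simpa using SetLike.GradedMul.mul_mem ha hm
    · intro j m hm
      exact ⟨m ⊗ₜ ⟨1, one⟩, tmul_mem_tensorPiece hm _, by simp⟩
  cases n with
  | zero => exact gen
  | succ n =>
    refine ⟨gen, .of_eq_bot n fun j => ?_⟩
    rw [eq_bot_iff]
    intro x hx
    have : spanMap A (𝒜 0) x = 0 := hx.2
    rw [Submodule.mem_bot, key x, this, TensorProduct.zero_tmul]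

end

end Linear

/-! ### Linearity under retracts and surjections of graded algebras -/

section ChangeOfRings

universe u

variable {k : Type u} [Field k] {A : Type u} [CommRing A] [Algebra k A] {𝒜 : ℕ → Submodule k A}
  {C : Type u} [CommRing C] [Algebra k C] {𝒞 : ℕ → Submodule k C}

/-- Linearity passes to retracts, along a retraction of graded algebras. -/
lemma IsLinearUpTo.of_retract [SetLike.GradedMonoid 𝒜] {n : ℕ} {ι : A →ₐ[k] C} {ρ : C →ₐ[k] A}
    (hι : ∀ j, ∀ a ∈ 𝒜 j, ι a ∈ 𝒞 j) (hρ : ∀ j, ∀ c ∈ 𝒞 j, ρ c ∈ 𝒜 j) (hρι : ∀ a, ρ (ι a) = a)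
    {N : Type u} [AddCommGroup N] [Module k N] [Module C N] [IsScalarTower k C N]
    {𝒩 : ℕ → Submodule k N} (hN : IsLinearUpTo 𝒞 n N 𝒩)
    {M : Type u} [AddCommGroup M] [Module k M] [Module A M] [IsScalarTower k A M]
    {ℳ : ℕ → Submodule k M} (hM : ∀ j, ∀ a ∈ 𝒜 j, ∀ m ∈ ℳ 0, a • m ∈ ℳ j)
    (s : M →ₗ[k] N) (t : N →ₗ[k] M) (hs : ∀ a m, s (a • m) = ι a • s m)
    (ht : ∀ c x, t (c • x) = ρ c • t x) (hsj : ∀ j, ∀ m ∈ ℳ j, s m ∈ 𝒩 j)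
    (htj : ∀ j, ∀ x ∈ 𝒩 j, t x ∈ ℳ j) (hts : ∀ j, ∀ m ∈ ℳ j, t (s m) = m) :
    IsLinearUpTo 𝒜 n M ℳ := by
  -- This and `gen` are stated for all modules because the induction below replaces `N` and `M` by
  -- their syzygies.
  have tspan : ∀ {N : Type u} [AddCommGroup N] [Module k N] [Module C N] [IsScalarTower k C N]
      (𝒩 : ℕ → Submodule k N) {M : Type u} [AddCommGroup M] [Module k M] [Module A M]
      [IsScalarTower k A M] (ℳ : ℕ → Submodule k M) (t : N →ₗ[k] M)
      (_ : ∀ c x, t (c • x) = ρ c • t x) (htj : ∀ x ∈ 𝒩 0, t x ∈ ℳ 0) (x : C ⊗[k] 𝒩 0),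
      spanMap A (ℳ 0) (TensorProduct.map ρ.toLinearMap (t.restrict htj) x) =
        t (spanMap C (𝒩 0) x) := by
    intro N _ _ _ _ 𝒩 M _ _ _ _ ℳ t ht htj x
    induction x using TensorProduct.induction_on with
    | zero => simp
    | tmul a v => simp [ht]
    | add a b ha hb => simp only [map_add, ha, hb]
  have gen : ∀ {N : Type u} [AddCommGroup N] [Module k N] [Module C N] [IsScalarTower k C N]
      (𝒩 : ℕ → Submodule k N) (_ : GeneratedInDegreeZero 𝒞 𝒩)
      {M : Type u} [AddCommGroup M] [Module k M] [Module A M] [IsScalarTower k A M]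
      (ℳ : ℕ → Submodule k M) (_ : ∀ j, ∀ a ∈ 𝒜 j, ∀ m ∈ ℳ 0, a • m ∈ ℳ j)
      (s : M →ₗ[k] N) (t : N →ₗ[k] M) (_ : ∀ c x, t (c • x) = ρ c • t x)
      (_ : ∀ j, ∀ m ∈ ℳ j, s m ∈ 𝒩 j) (_ : ∀ j, ∀ x ∈ 𝒩 j, t x ∈ ℳ j)
      (_ : ∀ j, ∀ m ∈ ℳ j, t (s m) = m), GeneratedInDegreeZero 𝒜 ℳ := by
    intro N _ _ _ _ 𝒩 hN M _ _ _ _ ℳ hM s t ht hsj htj hts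
    refine ⟨?_, hM, fun j m hm => ?_⟩
    · have := hN.finite
      refine FiniteDimensional.of_injective (s.restrict (hsj 0)) ?_
      intro x y hxy
      ext
      rw [← hts 0 x x.2, ← hts 0 y y.2]
      exact congrArg t (congrArg Subtype.val hxy)
    · obtain ⟨x, hx, e⟩ := hN.exists_eq j _ (hsj j m hm)
      refine ⟨TensorProduct.map ρ.toLinearMap (t.restrict (htj 0)) x, ?_, ?_⟩
      · exact apply_mem_of_mem_tensorPiece
          (fun a ha v => by simpa using tmul_mem_tensorPiece (hρ j a ha) _) hx
      · rw [tspan 𝒩 ℳ t ht (htj 0), e, hts j m hm]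
  induction n generalizing M N with
  | zero => exact gen 𝒩 hN ℳ hM s t ht hsj htj hts
  | succ n ih =>
    refine ⟨gen 𝒩 hN.1 ℳ hM s t ht hsj htj hts, ?_⟩
    -- The maps ι ⊗ s and ρ ⊗ t exhibit the syzygy of `M` as a retract of that of `N`.
    refine ih hN.2 (smul_syzygy_mem ℳ) (TensorProduct.map ι.toLinearMap (s.restrict (hsj 0)))
      (TensorProduct.map ρ.toLinearMap (t.restrict (htj 0))) ?_ ?_ ?_ ?_ ?_
    · intro a x
      induction x using TensorProduct.induction_on with
      | zero => simp
      | tmul b v => simp [TensorProduct.smul_tmul']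
      | add x y hx hy => simp only [smul_add, map_add, hx, hy]
    · intro a x
      induction x using TensorProduct.induction_on with
      | zero => simp
      | tmul b v => simp [TensorProduct.smul_tmul']
      | add x y hx hy => simp only [smul_add, map_add, hx, hy]
    · intro j x hx
      refine ⟨apply_mem_of_mem_tensorPiece
        (fun a ha v => by simpa using tmul_mem_tensorPiece (hι _ a ha) _) hx.1, ?_⟩
      have h0 : spanMap A (ℳ 0) x = 0 := hx.2
      have : ∀ x, spanMap C (𝒩 0) (TensorProduct.map ι.toLinearMap (s.restrict (hsj 0)) x) =
          s (spanMap A (ℳ 0) x) := by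
        intro x
        induction x using TensorProduct.induction_on with
        | zero => simp
        | tmul a v => simp [hs]
        | add a b ha hb => simp only [map_add, ha, hb]
      change spanMap C (𝒩 0) _ = 0
      rw [this, h0, map_zero]
    · intro j x hx
      refine ⟨apply_mem_of_mem_tensorPiece
        (fun a ha v => by simpa using tmul_mem_tensorPiece (hρ _ a ha) _) hx.1, ?_⟩
      have h0 : spanMap C (𝒩 0) x = 0 := hx.2
      change spanMap A (ℳ 0) _ = 0
      rw [tspan 𝒩 ℳ t ht (htj 0), h0, map_zero]
    · intro j x _
      rw [← LinearMap.comp_apply, ← TensorProduct.map_comp]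
      have h1 : ρ.toLinearMap ∘ₗ ι.toLinearMap = LinearMap.id := LinearMap.ext hρι
      have h2 : t.restrict (htj 0) ∘ₗ s.restrict (hsj 0) = LinearMap.id :=
        LinearMap.ext fun m => Subtype.ext (hts 0 m m.2)
      rw [h1, h2, TensorProduct.map_id, LinearMap.id_apply]

section Surjection

variable [Algebra C A] [IsScalarTower k C A]

/-- The graded pieces, shifted by one, of the kernel of a homomorphism of graded algebras. -/
def kernelPiece (𝒞 : ℕ → Submodule k C) (A : Type u) [CommRing A] [Algebra k A] [Algebra C A]
    [IsScalarTower k C A] (j : ℕ) : Submodule k C :=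
  𝒞 (j + 1) ⊓ LinearMap.ker (IsScalarTower.toAlgHom k C A).toLinearMap

variable {M : Type u} [AddCommGroup M] [Module k M] [Module A M] [IsScalarTower k A M]
  [Module C M] [IsScalarTower k C M] [IsScalarTower C A M] {ℳ : ℕ → Submodule k M}

lemma spanMap_rTensor (V : Submodule k M) (x : C ⊗[k] V) :
    spanMap A V ((IsScalarTower.toAlgHom k C A).toLinearMap.rTensor V x) = spanMap C V x := by
  induction x using TensorProduct.induction_on with
  | zero => simp
  | tmul a v => simp
  | add a b ha hb => simp only [map_add, ha, hb]

lemma generatedInDegreeZero_iff_of_surjective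
    (h : ∀ j a, a ∈ 𝒜 j ↔ ∃ c ∈ 𝒞 j, algebraMap C A c = a) :
    GeneratedInDegreeZero 𝒞 ℳ ↔ GeneratedInDegreeZero 𝒜 ℳ := by
  constructor
  · intro H
    refine ⟨H.finite, fun j a ha m hm => ?_, fun j m hm => ?_⟩
    · obtain ⟨c, hc, rfl⟩ := (h j a).1 ha
      rw [algebraMap_smul]
      exact H.smul_mem j c hc m hm
    · obtain ⟨x, hx, rfl⟩ := H.exists_eq j m hm
      refine ⟨(IsScalarTower.toAlgHom k C A).toLinearMap.rTensor _ x, ?_, spanMap_rTensor _ x⟩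
      exact apply_mem_of_mem_tensorPiece
        (fun c hc v => by simpa using tmul_mem_tensorPiece ((h j _).2 ⟨c, hc, rfl⟩) v) hx
  · intro H
    refine ⟨H.finite, fun j c hc m hm => ?_, fun j m hm => ?_⟩
    · rw [← algebraMap_smul A c m]
      exact H.smul_mem j _ ((h j _).2 ⟨c, hc, rfl⟩) m hm
    · obtain ⟨x, hx, rfl⟩ := H.exists_eq j m hm
      obtain ⟨y, hy, rfl⟩ := exists_mem_tensorPiece_map_eq (V := ℳ 0)
        (φ := (IsScalarTower.toAlgHom k C A).toLinearMap)
        (f := LinearMap.id) (fun a ha => (h j a).1 ha) Function.surjective_id hx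
      exact ⟨y, hy, (spanMap_rTensor _ y).symm⟩

/-- The cover over `C` factors through the cover over `A`, and the kernel of C ⊗ ℳ₀ → A ⊗ ℳ₀ is the
kernel of C → A tensored with ℳ₀. So the two syzygies differ exactly by copies of that kernel. -/
lemma syzygy_shortExact_of_surjective [SetLike.GradedMonoid 𝒞]
    (h : ∀ j a, a ∈ 𝒜 j ↔ ∃ c ∈ 𝒞 j, algebraMap C A c = a) :
    GradedShortExact 𝒞 (fun j => tensorPiece (kernelPiece 𝒞 A j) (ℳ 0)) (syzygy 𝒞 ℳ)
      (syzygy 𝒜 ℳ) (LinearMap.id : C ⊗[k] ℳ 0 →ₗ[C] C ⊗[k] ℳ 0)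
      (TensorProduct.AlgebraTensorModule.rTensor k (ℳ 0) (Algebra.linearMap C A)) := by
  have hg : ∀ x : C ⊗[k] ℳ 0,
      TensorProduct.AlgebraTensorModule.rTensor k (ℳ 0) (Algebra.linearMap C A) x =
        (IsScalarTower.toAlgHom k C A).toLinearMap.rTensor _ x := fun x => rfl
  have hker : ∀ j, ∀ x ∈ tensorPiece (kernelPiece 𝒞 A j) (ℳ 0),
      (IsScalarTower.toAlgHom k C A).toLinearMap.rTensor _ x = 0 := by
    intro j x hx
    have := apply_mem_of_mem_tensorPiece (S := ⊥)
      (L := (IsScalarTower.toAlgHom k C A).toLinearMap.rTensor (ℳ 0)) (fun c hc v => by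
        have : algebraMap C A c = 0 := hc.2
        simp [this]) hx
    simpa using this
  refine ⟨smul_syzygy_mem ℳ, ?_, ?_, ?_, ?_, ?_, ?_⟩
  · intro j x hx
    refine ⟨tensorPiece_le (P := kernelPiece 𝒞 A j) (N := tensorPiece (𝒞 (j + 1)) _)
      (fun a ha v => tmul_mem_tensorPiece ha.1 v) hx, ?_⟩
    change spanMap C (ℳ 0) x = 0
    rw [← spanMap_rTensor (A := A), hker j x hx, map_zero]
  · intro j x hx
    refine ⟨?_, ?_⟩
    · rw [hg]
      exact apply_mem_of_mem_tensorPiece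
        (fun c hc v => by simpa using tmul_mem_tensorPiece ((h _ _).2 ⟨c, hc, rfl⟩) v) hx.1
    · change spanMap A (ℳ 0) _ = 0
      rw [hg, spanMap_rTensor]
      exact hx.2
  · intro j x _ h0
    exact h0
  · intro j x hx
    rw [hg]
    exact hker j x hx
  · intro j x hx h0
    exact ⟨x, mem_tensorPiece_inf_ker hx.1 h0, rfl⟩
  · intro j x hx
    obtain ⟨y, hy, rfl⟩ := exists_mem_tensorPiece_map_eq (V := ℳ 0)
      (φ := (IsScalarTower.toAlgHom k C A).toLinearMap)
      (f := LinearMap.id) (fun a ha => (h _ a).1 ha) Function.surjective_id hx.1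
    refine ⟨y, ⟨hy, ?_⟩, rfl⟩
    change spanMap C (ℳ 0) y = 0
    rw [← spanMap_rTensor (A := A)]
    exact hx.2

/-- If the kernel of a surjection of graded algebras has a linear resolution, then linearity over
the source and over the target are equivalent. -/
lemma isLinearUpTo_iff_of_surjective [SetLike.GradedMonoid 𝒞]
    (h : ∀ j a, a ∈ 𝒜 j ↔ ∃ c ∈ 𝒞 j, algebraMap C A c = a)
    (hJ : ∀ n, IsLinearUpTo 𝒞 n C (kernelPiece 𝒞 A)) (n : ℕ) :
    IsLinearUpTo 𝒞 n M ℳ ↔ IsLinearUpTo 𝒜 n M ℳ := by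
  induction n generalizing M with
  | zero => exact generatedInDegreeZero_iff_of_surjective h
  | succ n ih =>
    constructor
    · intro H
      have := H.1.finite
      -- The kernel term is linear, so linearity over `C` passes to the syzygy over `A`; the
      -- induction hypothesis, applied to that `A`-module, changes the ring.
      exact ⟨(generatedInDegreeZero_iff_of_surjective h).1 H.1,
        ih.1 (.of_shortExact_right (syzygy_shortExact_of_surjective h) ((hJ n).tensor _) H.2)⟩
    · intro H
      have := H.1.finite
      exact ⟨(generatedInDegreeZero_iff_of_surjective h).2 H.1,
        .of_shortExact_middle (syzygy_shortExact_of_surjective h) ((hJ n).tensor _) (ih.2 H.2)⟩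

/-- The irrelevant ideals of `C` and `A` are simultaneously linear. -/
lemma isLinearUpTo_irrelevant_iff_of_surjective [SetLike.GradedMonoid 𝒞]
    (h : ∀ j a, a ∈ 𝒜 j ↔ ∃ c ∈ 𝒞 j, algebraMap C A c = a)
    (hJ : ∀ n, IsLinearUpTo 𝒞 n C (kernelPiece 𝒞 A)) (n : ℕ) :
    IsLinearUpTo 𝒞 n C (fun j => 𝒞 (j + 1)) ↔ IsLinearUpTo 𝒜 n A (fun j => 𝒜 (j + 1)) := by
  have key : GradedShortExact 𝒞 (kernelPiece 𝒞 A) (fun j => 𝒞 (j + 1)) (fun j => 𝒜 (j + 1))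
      (LinearMap.id : C →ₗ[C] C) (Algebra.linearMap C A) := by
    refine ⟨?_, fun j m hm => hm.1, fun j m hm => (h _ _).2 ⟨m, hm, rfl⟩, fun j m _ h0 => h0,
      fun j m hm => hm.2, fun j m hm h0 => ⟨m, ⟨hm, h0⟩, rfl⟩, fun j m hm => (h _ _).1 hm⟩
    intro j a ha m hm
    exact SetLike.GradedMul.mul_mem ha hm
  -- Both irrelevant ideals are now compared over `C`, where they are the last two terms of `key`.
  rw [← isLinearUpTo_iff_of_surjective (C := C) h hJ]
  exact ⟨.of_shortExact_right key (hJ n), .of_shortExact_middle key (hJ n)⟩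

end Surjection

end ChangeOfRings

lemma linearMap_apply_eq_sum {A : Type*} [CommRing A] {r s : ℕ}
    (d : (Fin s → A) →ₗ[A] (Fin r → A)) (y : Fin s → A) (c : Fin r) :
    d y c = ∑ b, y b * d (Pi.single b 1) c := by
  rw [LinearMap.pi_apply_eq_sum_univ d y, Finset.sum_apply]
  refine Finset.sum_congr rfl fun b _ => ?_
  have : (fun j => if b = j then 1 else 0) = (Pi.single b 1 : Fin s → A) := by
    ext j
    simp [Pi.single_apply, eq_comm]
  rw [this, Pi.smul_apply, smul_eq_mul]

/-! ### Koszulness as linearity of the irrelevant ideal -/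

section Resolution

universe u

variable {k : Type u} [Field k] {A : Type u} [CommRing A] [Algebra k A] (𝒜 : ℕ → Submodule k A)

/-- The elements of a submodule of `Aʳ` all of whose coordinates have degree `j + 1`. -/
def linearPiece {r : ℕ} (N : Submodule A (Fin r → A)) (j : ℕ) : Submodule k (Fin r → A) :=
  (Submodule.pi Set.univ fun _ => 𝒜 (j + 1)) ⊓ N.restrictScalars k

variable {𝒜}

lemma mem_linearPiece {r : ℕ} {N : Submodule A (Fin r → A)} {j : ℕ} {x : Fin r → A} :
    x ∈ linearPiece 𝒜 N j ↔ (∀ b, x b ∈ 𝒜 (j + 1)) ∧ x ∈ N := by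
  simp [linearPiece, Submodule.mem_pi]

variable [GradedAlgebra 𝒜]

lemma proj_mem (j : ℕ) (a : A) : GradedRing.proj 𝒜 j a ∈ 𝒜 j := by
  rw [GradedRing.proj_apply]; exact SetLike.coe_mem _

lemma proj_eq_self {j : ℕ} {a : A} (ha : a ∈ 𝒜 j) : GradedRing.proj 𝒜 j a = a := by
  rw [GradedRing.proj_apply, DirectSum.decompose_of_mem_same _ ha]

lemma proj_eq_zero {i j : ℕ} {a : A} (ha : a ∈ 𝒜 i) (h : i ≠ j) : GradedRing.proj 𝒜 j a = 0 := by
  rw [GradedRing.proj_apply, DirectSum.decompose_of_mem_ne _ ha h]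

lemma proj_succ_mul {j : ℕ} (a : A) {b : A} (hb : b ∈ 𝒜 1) :
    GradedRing.proj 𝒜 (j + 1) (a * b) = GradedRing.proj 𝒜 j a * b := by
  simp only [GradedRing.proj_apply]
  exact DirectSum.coe_decompose_mul_add_of_right_mem 𝒜 hb

lemma proj_zero_mul {i : ℕ} (hi : 0 < i) (a : A) {b : A} (hb : b ∈ 𝒜 i) :
    GradedRing.proj 𝒜 0 (a * b) = 0 := by
  rw [GradedRing.proj_apply]
  exact DirectSum.coe_decompose_mul_of_right_mem_of_not_le 𝒜 hb (by lia)

lemma mem_positiveIdeal_iff (a : A) : a ∈ positiveIdeal 𝒜 ↔ GradedRing.proj 𝒜 0 a = 0 := by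
  classical
  constructor
  · intro h
    induction h using Submodule.span_induction with
    | mem x hx =>
      obtain ⟨i, hi, hx⟩ := hx
      exact proj_eq_zero hx hi.ne'
    | zero => simp
    | add x y _ _ hx hy => rw [map_add, hx, hy, add_zero]
    | smul c x _ hx =>
      have h := map_mul (GradedRing.projZeroRingHom 𝒜) c x
      simp only [GradedRing.projZeroRingHom_apply, ← GradedRing.proj_apply] at h
      rw [smul_eq_mul, h, hx, mul_zero]
  · intro h
    rw [← DirectSum.sum_support_decompose 𝒜 a]
    refine sum_mem fun i _ => ?_
    rcases Nat.eq_zero_or_pos i with rfl | hi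
    · rw [GradedRing.proj_apply] at h
      rw [h]
      exact zero_mem _
    · exact Ideal.subset_span ⟨i, hi, SetLike.coe_mem _⟩

lemma mem_of_proj_mem {r : ℕ} {N : Submodule A (Fin r → A)} {x : Fin r → A}
    (h : ∀ j, (fun b => GradedRing.proj 𝒜 j (x b)) ∈ N) : x ∈ N := by
  classical
  have : x = ∑ j ∈ Finset.univ.biUnion fun b => (DirectSum.decompose 𝒜 (x b)).support,
      fun b => GradedRing.proj 𝒜 j (x b) := by
    ext b
    rw [Finset.sum_apply]
    conv_lhs => rw [← DirectSum.sum_support_decompose 𝒜 (x b)]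
    refine Finset.sum_subset (fun j hj => ?_) fun j _ hj => ?_
    · exact Finset.mem_biUnion.2 ⟨b, Finset.mem_univ _, hj⟩
    · simpa using hj
  rw [this]
  exact sum_mem fun j _ => h j

section Matrix

variable {r s : ℕ} {d : (Fin s → A) →ₗ[A] (Fin r → A)} (hd : ∀ b c, d (Pi.single b 1) c ∈ 𝒜 1)

include hd

/-- A matrix of linear forms is homogeneous of degree one, so it commutes with taking components up
to a shift. -/
lemma proj_succ_linearMap (j : ℕ) (y : Fin s → A) :
    (fun c => GradedRing.proj 𝒜 (j + 1) (d y c)) = d fun b => GradedRing.proj 𝒜 j (y b) := by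
  ext c
  rw [linearMap_apply_eq_sum, linearMap_apply_eq_sum, map_sum]
  exact Finset.sum_congr rfl fun b _ => proj_succ_mul _ (hd b c)

lemma proj_zero_linearMap (y : Fin s → A) (c : Fin r) : GradedRing.proj 𝒜 0 (d y c) = 0 := by
  rw [linearMap_apply_eq_sum, map_sum]
  exact Finset.sum_eq_zero fun b _ => proj_zero_mul one_pos _ (hd b c)

end Matrix

variable (𝒜) in
/-- An exact sequence of matrices of linear forms. -/
structure LinearComplex where
  rank : ℕ → ℕ
  d : ∀ i, (Fin (rank (i + 1)) → A) →ₗ[A] (Fin (rank i) → A)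
  mem : ∀ i b c, d i (Pi.single b 1) c ∈ 𝒜 1
  exact : ∀ i, Function.Exact (d (i + 1)) (d i)

namespace LinearComplex

variable (F : LinearComplex 𝒜)

omit [GradedAlgebra 𝒜] in
lemma d_eq_sum_smul (i : ℕ) (y : Fin (F.rank (i + 1)) → A) :
    F.d i y = ∑ b, y b • F.d i (Pi.single b 1) := by
  ext c
  rw [linearMap_apply_eq_sum]
  simp

/-- The columns of the matrix `d i`. -/
def column (i : ℕ) (b : Fin (F.rank (i + 1))) : linearPiece 𝒜 (LinearMap.range (F.d i)) 0 :=
  ⟨F.d i (Pi.single b 1), mem_linearPiece.2 ⟨F.mem i b, ⟨_, rfl⟩⟩⟩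

/-- A relation over `k` is a vector of constants in the kernel of `d i`, hence in the image of `d (i
+ 1)`; but entries of vectors in that image have no constant term. -/
lemma linearIndependent_column [Nontrivial A] (i : ℕ) : LinearIndependent k (F.column i) := by
  rw [Fintype.linearIndependent_iff]
  intro g hg
  have h1 : F.d i (fun b => algebraMap k A (g b)) = 0 := by
    rw [F.d_eq_sum_smul]
    have := congrArg Subtype.val hg
    simpa [column] using this
  obtain ⟨y, hy⟩ := (F.exact i _).1 h1
  intro b
  have h2 := proj_zero_linearMap (F.mem (i + 1)) y b
  rw [hy, proj_eq_self (SetLike.algebraMap_mem_graded 𝒜 _)] at h2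
  exact (map_eq_zero _).1 h2

lemma exists_of_mem_linearPiece (i : ℕ) {j : ℕ} {x : Fin (F.rank i) → A}
    (hx : x ∈ linearPiece 𝒜 (LinearMap.range (F.d i)) j) : ∃ y, (∀ b, y b ∈ 𝒜 j) ∧ F.d i y = x := by
  obtain ⟨hx1, y, rfl⟩ := mem_linearPiece.1 hx
  refine ⟨fun b => GradedRing.proj 𝒜 j (y b), fun b => proj_mem _ _, ?_⟩
  rw [← proj_succ_linearMap (F.mem i)]
  ext c
  exact proj_eq_self (hx1 c)

/-- The columns of `d i` form a basis of the degree one part of the image. -/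
noncomputable def columnBasis [Nontrivial A] (h0 : 𝒜 0 = 1) (i : ℕ) :
    Module.Basis (Fin (F.rank (i + 1))) k (linearPiece 𝒜 (LinearMap.range (F.d i)) 0) :=
  Module.Basis.mk (F.linearIndependent_column i) (by
    rintro ⟨x, hx⟩ -
    obtain ⟨y, hy, rfl⟩ := F.exists_of_mem_linearPiece i hx
    choose g hg using fun b => Submodule.mem_one.1 (h0 ▸ hy b)
    have : (⟨F.d i y, hx⟩ : linearPiece 𝒜 (LinearMap.range (F.d i)) 0) =
        ∑ b, g b • F.column i b := by
      refine Subtype.ext ((F.d_eq_sum_smul i y).trans ?_)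
      simp [column, ← hg]
    rw [this]
    exact sum_mem fun b _ => Submodule.smul_mem _ _ (Submodule.subset_span ⟨b, rfl⟩))

lemma spanMap_equivFun_symm [Nontrivial A] (h0 : 𝒜 0 = 1) (i : ℕ)
    (x : Fin (F.rank (i + 1)) → A) :
    spanMap A _ (((F.columnBasis h0 i).baseChange A).equivFun.symm x) = F.d i x := by
  rw [F.d_eq_sum_smul, Module.Basis.equivFun_symm_apply, map_sum]
  simp [columnBasis, column]

/-- The columns of `d i` identify the free cover of its image with the map `d i` itself, so by
exactness the first syzygy is the image of `d (i + 1)` and the induction proceeds along the complex.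
-/
lemma isLinearUpTo [Nontrivial A] (h0 : 𝒜 0 = 1) (n i : ℕ) :
    IsLinearUpTo 𝒜 n (Fin (F.rank i) → A) (linearPiece 𝒜 (LinearMap.range (F.d i))) := by
  have hmem : ∀ i j x, ((F.columnBasis h0 i).baseChange A).equivFun.symm x ∈
      tensorPiece (𝒜 j) _ ↔ ∀ b, x b ∈ 𝒜 j := by
    intro i j x
    rw [mem_tensorPiece_iff (F.columnBasis h0 i)]
    have := ((F.columnBasis h0 i).baseChange A).equivFun.apply_symm_apply x
    rw [Module.Basis.equivFun_apply] at this
    rw [this]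
  have gen : ∀ i, GeneratedInDegreeZero 𝒜 (linearPiece 𝒜 (LinearMap.range (F.d i))) := by
    intro i
    refine ⟨.of_basis (F.columnBasis h0 i), ?_, ?_⟩
    · intro j a ha x hx
      rw [mem_linearPiece] at hx ⊢
      exact ⟨fun b => SetLike.GradedMul.mul_mem ha (hx.1 b), Submodule.smul_mem _ _ hx.2⟩
    · intro j x hx
      obtain ⟨y, hy, rfl⟩ := F.exists_of_mem_linearPiece i hx
      exact ⟨_, (hmem i j y).2 hy, F.spanMap_equivFun_symm h0 i y⟩
  induction n generalizing i with
  | zero => exact gen i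
  | succ n ih =>
    refine ⟨gen i, (ih (i + 1)).of_bijOn
      ((F.columnBasis h0 i).baseChange A).equivFun.symm.toLinearMap ?_ ?_ ?_⟩
    · intro j x hx
      rw [mem_linearPiece] at hx
      refine ⟨(hmem i _ x).2 hx.1, ?_⟩
      change spanMap A _ (((F.columnBasis h0 i).baseChange A).equivFun.symm x) = 0
      rw [F.spanMap_equivFun_symm]
      exact (F.exact i x).2 hx.2
    · intro j m _ hm
      exact (LinearEquiv.map_eq_zero_iff _).1 hm
    · intro j m hm
      obtain ⟨x, rfl⟩ := ((F.columnBasis h0 i).baseChange A).equivFun.symm.surjective m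
      refine ⟨x, mem_linearPiece.2 ⟨(hmem i _ x).1 hm.1, (F.exact i x).1 ?_⟩, rfl⟩
      rw [← F.spanMap_equivFun_symm h0]
      exact hm.2

/-- If the image of `d 0` is a direct sum of copies of the ideal `J`, then `J` is linear. -/
lemma isLinearUpTo_ideal [Nontrivial A] (h0 : 𝒜 0 = 1) (hr : 0 < F.rank 0) {J : Ideal A}
    (hJ : ∀ x, x ∈ LinearMap.range (F.d 0) ↔ ∀ b, x b ∈ J) (n : ℕ) :
    IsLinearUpTo 𝒜 n A fun j => 𝒜 (j + 1) ⊓ J.restrictScalars k := by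
  -- The rank of the zeroth free module need not be 1, so `J` is extracted as the zeroth summand of
  -- a power of `J`, a retract over the identity of `A`.
  refine (F.isLinearUpTo h0 n 0).of_retract (ι := AlgHom.id k A) (ρ := AlgHom.id k A)
    (fun _ _ h => h) (fun _ _ h => h) (fun _ => rfl) ?_
    (LinearMap.single k (fun _ => A) ⟨0, hr⟩) (LinearMap.proj ⟨0, hr⟩) ?_ ?_ ?_ ?_ ?_
  · intro j a ha m hm
    exact ⟨SetLike.GradedMul.mul_mem ha hm.1, J.mul_mem_left a hm.2⟩
  · intro a m
    simp [← Pi.single_smul]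
  · intro a m
    simp
  · intro j m hm
    rw [mem_linearPiece, hJ]
    refine ⟨fun b => ?_, fun b => ?_⟩
    · rw [LinearMap.single_apply, Pi.single_apply]
      split_ifs
      · exact hm.1
      · exact zero_mem _
    · rw [LinearMap.single_apply, Pi.single_apply]
      split_ifs
      · exact hm.2
      · exact zero_mem _
  · intro j x hx
    rw [mem_linearPiece, hJ] at hx
    exact ⟨hx.1 _, hx.2 _⟩
  · intro j m _
    simp

end LinearComplex

lemma positiveIdeal_ne_top [Nontrivial A] : positiveIdeal 𝒜 ≠ ⊤ := by
  rw [Ne, Ideal.eq_top_iff_one, mem_positiveIdeal_iff, proj_eq_self SetLike.GradedOne.one_mem]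
  exact one_ne_zero

/-- The linear complex underlying a linear resolution of the residue field. -/
lemma IsKoszul.exists_linearComplex [Nontrivial A] (h : IsKoszul 𝒜) :
    ∃ F : LinearComplex 𝒜, 0 < F.rank 0 ∧
      ∀ x, x ∈ LinearMap.range (F.d 0) ↔ ∀ b, x b ∈ positiveIdeal 𝒜 := by
  obtain ⟨F, hmin, hlin⟩ := h
  refine ⟨⟨F.rank, F.d, fun i b c => F.d_homogeneous i b c 1 (by rw [hlin, hlin]), F.exact_succ⟩,
    ?_, ?_⟩
  · rcases Nat.eq_zero_or_pos (F.rank 0) with h0 | h0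
    · exfalso
      have : IsEmpty (Fin (F.rank 0)) := by rw [h0]; infer_instance
      have : Nontrivial (A ⧸ positiveIdeal 𝒜) :=
        Ideal.Quotient.nontrivial_iff.2 positiveIdeal_ne_top
      exact not_subsingleton _ F.aug_surjective.subsingleton
    · exact h0
  · intro x
    constructor
    · rintro ⟨y, rfl⟩ b
      exact hmin 0 y b
    · intro hx
      refine (F.exact_zero x).1 ?_
      rw [LinearMap.pi_apply_eq_sum_univ F.aug x]
      refine Finset.sum_eq_zero fun b _ => ?_
      obtain ⟨a, ha⟩ := Ideal.Quotient.mk_surjective (F.aug fun j => if b = j then 1 else 0)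
      rw [← ha, ← Ideal.Quotient.mk_eq_mk, ← Submodule.Quotient.mk_smul, smul_eq_mul,
        Ideal.Quotient.mk_eq_mk, Ideal.Quotient.eq_zero_iff_mem]
      exact Ideal.mul_mem_right _ _ (hx b)

variable (𝒜) in
/-- A submodule of `Aʳ` generated by vectors of linear forms and with a linear resolution. -/
structure LinearSubmodule where
  rank : ℕ
  carrier : Submodule A (Fin rank → A)
  linear : ∀ n, IsLinearUpTo 𝒜 n (Fin rank → A) (linearPiece 𝒜 carrier)
  proj_zero : ∀ x ∈ carrier, ∀ b, GradedRing.proj 𝒜 0 (x b) = 0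
  proj_succ : ∀ x ∈ carrier, ∀ j, (fun b => GradedRing.proj 𝒜 (j + 1) (x b)) ∈ carrier

namespace LinearSubmodule

variable (N : LinearSubmodule 𝒜)

/-- The minimal number of generators. -/
noncomputable def numGenerators : ℕ := Module.finrank k (linearPiece 𝒜 N.carrier 0)

/-- A minimal system of generators. -/
noncomputable def basis :
    Module.Basis (Fin N.numGenerators) k (linearPiece 𝒜 N.carrier 0) :=
  have := (N.linear 0).finite
  Module.finBasis k _

/-- The free cover given by a minimal system of generators. -/
noncomputable def cover : (Fin N.numGenerators → A) →ₗ[A] (Fin N.rank → A) :=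
  spanMap A (linearPiece 𝒜 N.carrier 0) ∘ₗ (N.basis.baseChange A).equivFun.symm.toLinearMap

lemma cover_apply (x : Fin N.numGenerators → A) :
    N.cover x = ∑ b, x b • (N.basis b : Fin N.rank → A) := by
  simp [cover, Module.Basis.equivFun_symm_apply]

lemma cover_single (b : Fin N.numGenerators) : N.cover (Pi.single b 1) = N.basis b := by
  rw [cover_apply, Finset.sum_eq_single b] <;> simp +contextual

lemma cover_single_mem (b : Fin N.numGenerators) (c : Fin N.rank) :
    N.cover (Pi.single b 1) c ∈ 𝒜 1 := by
  rw [cover_single]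
  exact (mem_linearPiece.1 (N.basis b).2).1 c

lemma equivFun_symm_mem_tensorPiece_iff (j : ℕ) (x : Fin N.numGenerators → A) :
    (N.basis.baseChange A).equivFun.symm x ∈ tensorPiece (𝒜 j) _ ↔ ∀ b, x b ∈ 𝒜 j := by
  rw [mem_tensorPiece_iff N.basis]
  have := (N.basis.baseChange A).equivFun.apply_symm_apply x
  rw [Module.Basis.equivFun_apply] at this
  rw [this]

/-- The carrier is determined by its homogeneous components: the one in degree zero vanishes, and
the others are generated by the linear ones. -/
lemma range_cover : LinearMap.range N.cover = N.carrier := by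
  apply le_antisymm
  · rintro _ ⟨x, rfl⟩
    rw [cover_apply]
    exact sum_mem fun b _ => Submodule.smul_mem _ _ (mem_linearPiece.1 (N.basis b).2).2
  · intro x hx
    refine mem_of_proj_mem (𝒜 := 𝒜) fun j => ?_
    rcases j with _ | j
    · have : (fun b => GradedRing.proj 𝒜 0 (x b)) = 0 := funext (N.proj_zero x hx)
      rw [this]
      exact zero_mem _
    · obtain ⟨y, -, e⟩ := (N.linear 0).exists_eq j (fun b => GradedRing.proj 𝒜 (j + 1) (x b))
        (mem_linearPiece.2 ⟨fun b => proj_mem _ _, N.proj_succ x hx j⟩)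
      exact ⟨(N.basis.baseChange A).equivFun y, by simp only [cover, LinearMap.comp_apply,
        LinearEquiv.coe_coe, LinearEquiv.symm_apply_apply, e]⟩

/-- Minimality of the cover: the degree zero component of a syzygy is a `k`-linear relation among
basis elements. -/
lemma proj_zero_of_cover_eq_zero (h0 : 𝒜 0 = 1) (x : Fin N.numGenerators → A)
    (hx : N.cover x = 0) (b : Fin N.numGenerators) : GradedRing.proj 𝒜 0 (x b) = 0 := by
  choose g hg using fun b => Submodule.mem_one.1 (h0 ▸ proj_mem (𝒜 := 𝒜) 0 (x b))
  have h1 := proj_succ_linearMap N.cover_single_mem 0 x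
  rw [hx, cover_apply] at h1
  have h2 : ∑ b, g b • N.basis b = 0 := by
    refine Subtype.ext (Eq.trans ?_ (h1.symm.trans ?_))
    · simp [← hg]
    · ext; simp
  have h3 := Fintype.linearIndependent_iff.1 N.basis.linearIndependent g h2 b
  rw [← hg, h3, map_zero]

/-- The first syzygy. -/
noncomputable def next (h0 : 𝒜 0 = 1) : LinearSubmodule 𝒜 where
  rank := N.numGenerators
  carrier := LinearMap.ker N.cover
  linear n := by
    refine (N.linear (n + 1)).2.of_bijOn (N.basis.baseChange A).equivFun.toLinearMap ?_ ?_ ?_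
    · intro j m hm
      obtain ⟨x, rfl⟩ := (N.basis.baseChange A).equivFun.symm.surjective m
      rw [LinearEquiv.coe_coe, LinearEquiv.apply_symm_apply, mem_linearPiece]
      exact ⟨(N.equivFun_symm_mem_tensorPiece_iff _ x).1 hm.1, hm.2⟩
    · intro j m _ hm
      exact (LinearEquiv.map_eq_zero_iff _).1 hm
    · intro j x hx
      rw [mem_linearPiece] at hx
      exact ⟨(N.basis.baseChange A).equivFun.symm x,
        ⟨(N.equivFun_symm_mem_tensorPiece_iff _ x).2 hx.1, hx.2⟩,
        LinearEquiv.apply_symm_apply _ x⟩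
  proj_zero := N.proj_zero_of_cover_eq_zero h0
  proj_succ x hx j := by
    rw [LinearMap.mem_ker] at hx ⊢
    rw [← proj_succ_linearMap N.cover_single_mem, hx]
    ext
    simp

end LinearSubmodule

/-- The irrelevant ideal as a submodule of `A¹`. -/
noncomputable def LinearSubmodule.irrelevant
    (h : ∀ n, IsLinearUpTo 𝒜 n A fun j => 𝒜 (j + 1)) : LinearSubmodule 𝒜 where
  rank := 1
  carrier := Submodule.pi Set.univ fun _ => positiveIdeal 𝒜
  linear n := by
    have : linearPiece 𝒜 (Submodule.pi Set.univ fun _ : Fin 1 => positiveIdeal 𝒜) =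
        fun j => Submodule.pi Set.univ fun _ => 𝒜 (j + 1) := by
      ext j x
      rw [mem_linearPiece]
      simp only [Submodule.mem_pi, Set.mem_univ, true_imp_iff, and_iff_left_iff_imp]
      exact fun hx b => Ideal.subset_span ⟨j + 1, j.succ_pos, hx b⟩
    rw [this]
    exact (h n).pi 1
  proj_zero x hx b := (mem_positiveIdeal_iff _).1 (hx b trivial)
  proj_succ x hx j b _ := Ideal.subset_span ⟨j + 1, j.succ_pos, proj_mem _ _⟩

/-- The iterated syzygies of the irrelevant ideal. -/
noncomputable def LinearSubmodule.iterate (h0 : 𝒜 0 = 1)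
    (h : ∀ n, IsLinearUpTo 𝒜 n A fun j => 𝒜 (j + 1)) : ℕ → LinearSubmodule 𝒜
  | 0 => LinearSubmodule.irrelevant h
  | i + 1 => (LinearSubmodule.iterate h0 h i).next h0

/-- The covers of the iterated syzygies splice into a resolution: the target of each cover is the
free module covering the previous syzygy, and the kernel of one cover is by definition the carrier
of the next. -/
lemma isKoszul_of_isLinearUpTo (h0 : 𝒜 0 = 1)
    (h : ∀ n, IsLinearUpTo 𝒜 n A fun j => 𝒜 (j + 1)) : IsKoszul 𝒜 := by
  let N := LinearSubmodule.iterate h0 h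
  refine ⟨{
    rank := fun i => (N i).rank
    deg := fun i _ => i
    d := fun i => (N i).cover
    aug := (positiveIdeal 𝒜).mkQ ∘ₗ LinearMap.proj (R := A) (φ := fun _ : Fin 1 => A) 0
    d_homogeneous := fun i b c m hm => ?_
    d_eq_zero := fun i b c hi => by lia
    aug_homogeneous := fun b hb => absurd rfl hb
    aug_surjective := ?_
    exact_zero := fun x => ?_
    exact_succ := fun i x => ?_ }, fun i x c => ?_, fun i b => rfl⟩
  · obtain rfl : m = 1 := by lia
    exact (N i).cover_single_mem b c
  · exact (Submodule.mkQ_surjective _).comp fun a => ⟨fun _ => a, rfl⟩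
  · change _ ↔ x ∈ LinearMap.range (N 0).cover
    rw [LinearSubmodule.range_cover]
    change Submodule.Quotient.mk (x (0 : Fin 1)) = 0 ↔ ∀ b, _ → x b ∈ positiveIdeal 𝒜
    rw [Submodule.Quotient.mk_eq_zero]
    refine ⟨fun hx b _ => ?_, fun hx => hx (0 : Fin 1) trivial⟩
    obtain rfl : b = (0 : Fin 1) := Subsingleton.elim (α := Fin 1) b 0
    exact hx
  · change _ ↔ x ∈ LinearMap.range (N (i + 1)).cover
    rw [LinearSubmodule.range_cover]
    exact Iff.rfl
  · rw [mem_positiveIdeal_iff]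
    exact (N i).proj_zero _ (by rw [← LinearSubmodule.range_cover]; exact ⟨x, rfl⟩) c

/-- A connected graded algebra is Koszul if and only if its irrelevant ideal is linear. -/
lemma isKoszul_iff_isLinearUpTo [Nontrivial A] (h0 : 𝒜 0 = 1) :
    IsKoszul 𝒜 ↔ ∀ n, IsLinearUpTo 𝒜 n A fun j => 𝒜 (j + 1) := by
  refine ⟨fun h n => ?_, isKoszul_of_isLinearUpTo h0⟩
  obtain ⟨F, hr, hF⟩ := h.exists_linearComplex
  convert F.isLinearUpTo_ideal h0 hr hF n using 2 with j
  rw [left_eq_inf]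
  exact fun a ha => Ideal.subset_span ⟨j + 1, j.succ_pos, ha⟩

end Resolution

/-! ### Gradings on quotient algebras -/

section ImageGrading

universe u

variable {k Q C : Type u} [Field k] [CommRing Q] [Algebra k Q] [CommRing C] [Algebra k C]

/-- The grading of a quotient algebra. -/
def imageGrading (𝒬 : ℕ → Submodule k Q) (π : Q →ₐ[k] C) (j : ℕ) : Submodule k C :=
  (𝒬 j).map π.toLinearMap

variable {𝒬 : ℕ → Submodule k Q} [GradedAlgebra 𝒬] {π : Q →ₐ[k] C}

/-- For independence, lift a relation between homogeneous elements to `Q`; its lift lies in the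
homogeneous kernel, so each component does. -/
lemma imageGrading_isInternal (hπ : Function.Surjective π)
    (hker : (RingHom.ker π).IsHomogeneous 𝒬) : DirectSum.IsInternal (imageGrading 𝒬 π) := by
  classical
  constructor
  · rw [injective_iff_map_eq_zero]
    intro x hx
    rw [DirectSum.coeAddMonoidHom_eq_dfinsuppSum] at hx
    choose q hq hqx using fun j => (x j).2
    replace hq : ∀ j, q j ∈ 𝒬 j := hq
    have h0 : ∑ j ∈ x.support, q j ∈ RingHom.ker π := by
      rw [RingHom.mem_ker, map_sum, ← hx]
      exact Finset.sum_congr rfl fun j _ => hqx j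
    ext j
    by_cases hj : j ∈ x.support
    · have h1 := hker j h0
      rw [← GradedRing.proj_apply, map_sum, Finset.sum_eq_single j
        (fun i _ hij => proj_eq_zero (𝒜 := 𝒬) (hq i) hij) (fun h => absurd hj h),
        proj_eq_self (hq j)] at h1
      rw [← hqx j]
      exact h1
    · rw [DFinsupp.notMem_support_iff.1 hj]
      rfl
  · intro c
    obtain ⟨q, rfl⟩ := hπ c
    refine ⟨∑ j ∈ (DirectSum.decompose 𝒬 q).support, DirectSum.of (fun j => imageGrading 𝒬 π j) j
      ⟨π (DirectSum.decompose 𝒬 q j), ⟨_, SetLike.coe_mem _, rfl⟩⟩, ?_⟩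
    rw [map_sum]
    conv_rhs => rw [← DirectSum.sum_support_decompose 𝒬 q, map_sum]
    exact Finset.sum_congr rfl fun j _ => DirectSum.coeAddMonoidHom_of _ _ _

/-- The quotient of a graded algebra by a homogeneous ideal is a graded algebra. -/
@[reducible] noncomputable def imageGradedAlgebra (hπ : Function.Surjective π)
    (hker : (RingHom.ker π).IsHomogeneous 𝒬) : GradedAlgebra (imageGrading 𝒬 π) where
  one_mem := ⟨1, SetLike.GradedOne.one_mem, map_one π⟩
  mul_mem := by
    rintro i j _ _ ⟨a, ha, rfl⟩ ⟨b, hb, rfl⟩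
    exact ⟨a * b, SetLike.GradedMul.mul_mem ha hb, map_mul π a b⟩
  toDecomposition := (imageGrading_isInternal hπ hker).chooseDecomposition

omit [GradedAlgebra 𝒬] in
lemma imageGrading_zero (h0 : 𝒬 0 = 1) : imageGrading 𝒬 π 0 = 1 := by
  rw [imageGrading, h0, Submodule.map_one]

end ImageGrading

/-! ### Koszulness under surjections, regular linear forms and retracts -/

section KoszulChangeOfRings

universe u

variable {k : Type u} [Field k] {A : Type u} [CommRing A] [Algebra k A] {𝒜 : ℕ → Submodule k A}
  {C : Type u} [CommRing C] [Algebra k C] {𝒞 : ℕ → Submodule k C}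
  [GradedAlgebra 𝒜] [GradedAlgebra 𝒞]

lemma isKoszul_iff_of_surjective [Nontrivial A] [Algebra C A] [IsScalarTower k C A]
    (hA : 𝒜 0 = 1) (hC : 𝒞 0 = 1) (h : ∀ j a, a ∈ 𝒜 j ↔ ∃ c ∈ 𝒞 j, algebraMap C A c = a)
    (hJ : ∀ n, IsLinearUpTo 𝒞 n C (kernelPiece 𝒞 A)) : IsKoszul 𝒞 ↔ IsKoszul 𝒜 := by
  have : Nontrivial C := (algebraMap C A).domain_nontrivial
  rw [isKoszul_iff_isLinearUpTo hA, isKoszul_iff_isLinearUpTo hC]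
  exact forall_congr' fun n => isLinearUpTo_irrelevant_iff_of_surjective h hJ n

/-- Koszulness is invariant under isomorphisms of graded algebras. -/
lemma isKoszul_iff_of_injective [Nontrivial A] (f : C →ₐ[k] A) (hA : 𝒜 0 = 1) (hC : 𝒞 0 = 1)
    (h : ∀ j a, a ∈ 𝒜 j ↔ ∃ c ∈ 𝒞 j, f c = a) (hf : Function.Injective f) :
    IsKoszul 𝒞 ↔ IsKoszul 𝒜 := by
  let := f.toRingHom.toAlgebra
  have : IsScalarTower k C A := .of_algebraMap_eq fun x => (f.commutes x).symm
  refine isKoszul_iff_of_surjective hA hC h fun n => .of_eq_bot n fun j => ?_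
  rw [eq_bot_iff]
  exact fun c hc => hf (hc.2.trans (map_zero f).symm)

/-- Koszulness is invariant under division by a regular linear form. -/
lemma isKoszul_iff_of_regular [Nontrivial A] (f : C →ₐ[k] A) (hA : 𝒜 0 = 1) (hC : 𝒞 0 = 1)
    (h : ∀ j a, a ∈ 𝒜 j ↔ ∃ c ∈ 𝒞 j, f c = a) {l : C} (hl : l ∈ 𝒞 1)
    (hreg : ∀ c, c * l = 0 → c = 0) (hker : ∀ c, f c = 0 ↔ ∃ p, p * l = c) :
    IsKoszul 𝒞 ↔ IsKoszul 𝒜 := by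
  let := f.toRingHom.toAlgebra
  have : IsScalarTower k C A := .of_algebraMap_eq fun x => (f.commutes x).symm
  -- Multiplication by `l` identifies `C` with the kernel, the shift by one in `kernelPiece`
  -- matching the degree of `l`.
  refine isKoszul_iff_of_surjective hA hC h fun n =>
    (IsLinearUpTo.self hC n).of_bijOn (LinearMap.mulRight C l) ?_ ?_ ?_
  · intro j c hc
    exact ⟨SetLike.GradedMul.mul_mem hc hl, (hker _).2 ⟨c, rfl⟩⟩
  · intro j c _
    exact hreg c
  · intro j c hc
    obtain ⟨p, rfl⟩ := (hker c).1 hc.2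
    refine ⟨GradedRing.proj 𝒞 j p, proj_mem _ _, ?_⟩
    rw [LinearMap.mulRight_apply, ← proj_succ_mul p hl]
    exact proj_eq_self hc.1

/-- Koszulness passes to algebra retracts. -/
lemma IsKoszul.of_retract [Nontrivial A] (hA : 𝒜 0 = 1) (hC : 𝒞 0 = 1) {ι : A →ₐ[k] C}
    {ρ : C →ₐ[k] A} (hι : ∀ j, ∀ a ∈ 𝒜 j, ι a ∈ 𝒞 j) (hρ : ∀ j, ∀ c ∈ 𝒞 j, ρ c ∈ 𝒜 j)
    (hρι : ∀ a, ρ (ι a) = a) (h : IsKoszul 𝒞) : IsKoszul 𝒜 := by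
  have : Nontrivial C := ρ.toRingHom.domain_nontrivial
  rw [isKoszul_iff_isLinearUpTo hA]
  rw [isKoszul_iff_isLinearUpTo hC] at h
  exact fun n => (h n).of_retract hι hρ hρι
    (fun j a ha m hm => SetLike.GradedMul.mul_mem ha hm)
    ι.toLinearMap ρ.toLinearMap (fun a m => map_mul ι a m) (fun a m => map_mul ρ a m)
    (fun j => hι (j + 1)) (fun j => hρ (j + 1)) fun _ m _ => hρι m

end KoszulChangeOfRings

/-! ### Tensor products over the field -/

section Tensor

universe u

variable {k : Type u} [Field k]

section BaseChange

variable {A C : Type*} [CommRing A] [CommRing C] [Algebra A C] {r s t : ℕ}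

/-- The extension of scalars of a matrix. -/
noncomputable def baseChangePi (C : Type*) [CommRing C] [Algebra A C]
    (d : (Fin s → A) →ₗ[A] (Fin r → A)) : (Fin s → C) →ₗ[C] (Fin r → C) :=
  (TensorProduct.piScalarRight A C C (Fin r)).toLinearMap ∘ₗ d.baseChange C ∘ₗ
    (TensorProduct.piScalarRight A C C (Fin s)).symm.toLinearMap

lemma baseChangePi_piScalarRight (d : (Fin s → A) →ₗ[A] (Fin r → A)) (x : C ⊗[A] (Fin s → A)) :
    baseChangePi C d (TensorProduct.piScalarRight A C C (Fin s) x) =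
      TensorProduct.piScalarRight A C C (Fin r) (d.baseChange C x) := by
  simp only [baseChangePi, LinearMap.comp_apply, LinearEquiv.coe_coe, LinearEquiv.symm_apply_apply]

lemma piScalarRight_one_tmul (y : Fin s → A) :
    TensorProduct.piScalarRight A C C (Fin s) (1 ⊗ₜ y) = fun b => algebraMap A C (y b) := by
  ext c
  simp [Algebra.smul_def]

lemma baseChangePi_algebraMap (d : (Fin s → A) →ₗ[A] (Fin r → A)) (y : Fin s → A) :
    baseChangePi C d (fun b => algebraMap A C (y b)) = fun c => algebraMap A C (d y c) := by
  rw [← piScalarRight_one_tmul, baseChangePi_piScalarRight, LinearMap.baseChange_tmul,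
    piScalarRight_one_tmul]

lemma baseChangePi_single (d : (Fin s → A) →ₗ[A] (Fin r → A)) (b : Fin s) (c : Fin r) :
    baseChangePi C d (Pi.single b 1) c = algebraMap A C (d (Pi.single b 1) c) := by
  have e : (fun i => algebraMap A C ((Pi.single b 1 : Fin s → A) i)) = Pi.single b 1 := by
    ext i
    simp only [Pi.single_apply]
    split_ifs <;> simp
  rw [← e, baseChangePi_algebraMap]

lemma baseChangePi_exact [Module.Flat A C] {d : (Fin s → A) →ₗ[A] (Fin r → A)}
    {d' : (Fin t → A) →ₗ[A] (Fin s → A)} (h : Function.Exact d' d) :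
    Function.Exact (baseChangePi C d') (baseChangePi C d) := by
  have := Module.Flat.lTensor_exact C h
  intro x
  obtain ⟨x, rfl⟩ := (TensorProduct.piScalarRight A C C (Fin s)).surjective x
  rw [baseChangePi_piScalarRight, LinearEquiv.map_eq_zero_iff]
  refine (this x).trans ?_
  constructor
  · rintro ⟨y, rfl⟩
    exact ⟨TensorProduct.piScalarRight A C C _ y, baseChangePi_piScalarRight d' y⟩
  · rintro ⟨y, hy⟩
    obtain ⟨y, rfl⟩ := (TensorProduct.piScalarRight A C C (Fin t)).surjective y
    rw [baseChangePi_piScalarRight] at hy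
    exact ⟨y, LinearEquiv.injective _ hy⟩

/-- Ensures that a base-changed resolution of copies of `J` resolves copies of the extended ideal.
It can be checked one coordinate at a time, on the generators coming from `J`. -/
lemma mem_range_baseChangePi_iff {d : (Fin s → A) →ₗ[A] (Fin r → A)} {J : Ideal A}
    (hJ : ∀ x, x ∈ LinearMap.range d ↔ ∀ b, x b ∈ J) (x : Fin r → C) :
    x ∈ LinearMap.range (baseChangePi C d) ↔ ∀ b, x b ∈ J.map (algebraMap A C) := by
  constructor
  · rintro ⟨y, rfl⟩ b
    rw [linearMap_apply_eq_sum]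
    refine sum_mem fun c _ => Ideal.mul_mem_left _ _ ?_
    rw [baseChangePi_single]
    exact Ideal.mem_map_of_mem _ ((hJ _).1 ⟨_, rfl⟩ b)
  · intro hx
    have hs : x = ∑ b, Pi.single b (x b) := (Finset.univ_sum_single x).symm
    rw [hs]
    refine sum_mem fun b _ => ?_
    have key : J.map (algebraMap A C) ≤ (LinearMap.range (baseChangePi C d)).comap
        (LinearMap.single C (fun _ => C) b) := by
      rw [Ideal.map_le_iff_le_comap]
      intro a ha
      obtain ⟨y, hy⟩ := (hJ (Pi.single b a)).2 fun c => by
        rw [Pi.single_apply]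
        split_ifs
        · exact ha
        · exact zero_mem _
      refine ⟨fun c => algebraMap A C (y c), ?_⟩
      rw [baseChangePi_algebraMap, hy]
      ext c
      simp only [LinearMap.single_apply, Pi.single_apply]
      split_ifs <;> simp
    exact key (hx b)

end BaseChange

/-- The base change of a linear complex along a flat homomorphism. -/
noncomputable def LinearComplex.baseChange {A C : Type u} [CommRing A] [Algebra k A] [CommRing C]
    [Algebra k C] [Algebra A C] [Module.Flat A C] {𝒜 : ℕ → Submodule k A}
    {𝒞 : ℕ → Submodule k C} [GradedAlgebra 𝒜] [GradedAlgebra 𝒞]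
    (h : ∀ a ∈ 𝒜 1, algebraMap A C a ∈ 𝒞 1)
    (F : LinearComplex 𝒜) : LinearComplex 𝒞 where
  rank := F.rank
  d i := baseChangePi C (F.d i)
  mem i b c := baseChangePi_single (C := C) (F.d i) b c ▸ h _ (F.mem i b c)
  exact i := baseChangePi_exact (F.exact i)

variable {A B : Type u} [CommRing A] [Algebra k A] [CommRing B] [Algebra k B]
  {𝒜 : ℕ → Submodule k A} {ℬ : ℕ → Submodule k B} [GradedAlgebra 𝒜] [GradedAlgebra ℬ]

/-- The tensor product over `k` is Koszul if and only if both factors are. -/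
theorem isKoszul_tensorProduct_iff [Nontrivial A] [Nontrivial B]
    {𝒞 : ℕ → Submodule k (A ⊗[k] B)} [GradedAlgebra 𝒞]
    (hA : 𝒜 0 = 1) (hB : ℬ 0 = 1) (hC : 𝒞 0 = 1) (εA : A →ₐ[k] k) (εB : B →ₐ[k] k)
    (hε : ∀ i, 0 < i → ∀ a ∈ 𝒜 i, εA a = 0)
    (hl : ∀ j, ∀ a ∈ 𝒜 j, a ⊗ₜ 1 ∈ 𝒞 j) (hr : ∀ j, ∀ b ∈ ℬ j, 1 ⊗ₜ b ∈ 𝒞 j)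
    (hρ₁ : ∀ j, ∀ c ∈ 𝒞 j, Algebra.TensorProduct.lift (AlgHom.id k A)
      ((Algebra.ofId k A).comp εB) (fun _ _ => Commute.all _ _) c ∈ 𝒜 j)
    (hρ₂ : ∀ j, ∀ c ∈ 𝒞 j, Algebra.TensorProduct.lift ((Algebra.ofId k B).comp εA)
      (AlgHom.id k B) (fun _ _ => Commute.all _ _) c ∈ ℬ j) :
    IsKoszul 𝒞 ↔ IsKoszul 𝒜 ∧ IsKoszul ℬ := by
  have hret : IsKoszul 𝒞 → IsKoszul 𝒜 :=
    IsKoszul.of_retract hA hC (ι := Algebra.TensorProduct.includeLeft) hl hρ₁ fun a => by simp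
  -- Either side of the equivalence forces `𝒜` to be Koszul, so its linear resolution may be used to
  -- control the kernel of A ⊗ B → B.
  suffices IsKoszul 𝒜 → (IsKoszul 𝒞 ↔ IsKoszul ℬ) from
    ⟨fun h => ⟨hret h, (this (hret h)).1 h⟩, fun h => (this h.1).2 h.2⟩
  intro hK
  obtain ⟨F, hF, hJ⟩ := hK.exists_linearComplex
  let ρ : A ⊗[k] B →ₐ[k] B := Algebra.TensorProduct.lift ((Algebra.ofId k B).comp εA)
    (AlgHom.id k B) (fun _ _ => Commute.all _ _)
  have hker : ∀ c, ρ c = 0 ↔ c ∈ (positiveIdeal 𝒜).map (algebraMap A (A ⊗[k] B)) := by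
    have hε' : positiveIdeal 𝒜 ≤ RingHom.ker εA :=
      Ideal.span_le.2 fun a ⟨i, hi, ha⟩ => hε i hi a ha
    have hpos : ∀ a, a - algebraMap k A (εA a) ∈ positiveIdeal 𝒜 := by
      intro a
      have h1 : a - GradedRing.proj 𝒜 0 a ∈ positiveIdeal 𝒜 := by
        rw [mem_positiveIdeal_iff, map_sub, proj_eq_self (proj_mem 0 a), sub_self]
      obtain ⟨c, hc⟩ := Submodule.mem_one.1 (hA ▸ proj_mem (𝒜 := 𝒜) 0 a)
      have h2 : εA (a - GradedRing.proj 𝒜 0 a) = 0 := hε' h1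
      rw [map_sub, sub_eq_zero, ← hc, AlgHom.commutes] at h2
      rw [h2]
      change a - algebraMap k A c ∈ _
      rwa [hc]
    intro c
    constructor
    · intro h
      -- Modulo the extension of A₊, every a ⊗ b equals 1 ⊗ ε(a)b, because a - ε(a) lies in A₊.
      have key : ∀ c, c - 1 ⊗ₜ ρ c ∈ (positiveIdeal 𝒜).map (algebraMap A (A ⊗[k] B)) := by
        intro c
        induction c using TensorProduct.induction_on with
        | zero => simp
        | tmul a b =>
          have : a ⊗ₜ[k] b - 1 ⊗ₜ ρ (a ⊗ₜ b) =
              algebraMap A (A ⊗[k] B) (a - algebraMap k A (εA a)) * (1 ⊗ₜ b) := by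
            have e : (1 : A) ⊗ₜ[k] ρ (a ⊗ₜ b) = algebraMap k A (εA a) ⊗ₜ b := by
              simp [ρ, Algebra.ofId_apply, Algebra.algebraMap_eq_smul_one,
                TensorProduct.smul_tmul]
            rw [e, ← TensorProduct.sub_tmul]
            simp [Algebra.TensorProduct.algebraMap_apply]
          rw [this]
          exact Ideal.mul_mem_right _ _ (Ideal.mem_map_of_mem _ (hpos a))
        | add x y hx hy =>
          rw [map_add, TensorProduct.tmul_add, add_sub_add_comm]
          exact add_mem hx hy
      have := key c
      rwa [h, TensorProduct.tmul_zero, sub_zero] at this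
    · intro h
      have : (positiveIdeal 𝒜).map (algebraMap A (A ⊗[k] B)) ≤ RingHom.ker ρ := by
        rw [Ideal.map_le_iff_le_comap]
        intro a ha
        have : εA a = 0 := hε' ha
        simp [ρ, this]
      exact this h
  have : Nontrivial (A ⊗[k] B) := by
    have : ρ 1 ≠ ρ 0 := by simp
    exact ⟨1, 0, fun h => this (by rw [h])⟩
  -- A ⊗ B is flat over `A`, so the linear complex of A₊ stays exact and shows that the kernel of
  -- `ρ` is linear.
  have hlin := (F.baseChange (𝒞 := 𝒞) (hl 1)).isLinearUpTo_ideal hC hF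
    (mem_range_baseChangePi_iff hJ)
  let := ρ.toRingHom.toAlgebra
  have : IsScalarTower k (A ⊗[k] B) B := .of_algebraMap_eq fun x => (ρ.commutes x).symm
  refine isKoszul_iff_of_surjective hB hC (fun j b => ⟨fun hb => ?_, ?_⟩) fun n => ?_
  · exact ⟨1 ⊗ₜ b, hr j b hb, by change ρ _ = b; simp [ρ]⟩
  · rintro ⟨c, hc, rfl⟩
    exact hρ₂ j c hc
  · convert hlin n using 2 with j
    ext c
    exact and_congr_right fun _ => hker c

end Tensor

/-! ### Vanishing of Tor₁ for cyclic modules -/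

section Tor

universe u

open CategoryTheory

/-- An explicit form of Tor₁(R/I, R/J) = (I ∩ J)/IJ. For f in I ∩ J and a lift e of 1, write f e =
d₁ z. As f kills R/I, 1 ⊗ z is a cycle, hence a boundary, so z ≡ d₂ w modulo I P₁. A lift φ : P₀ → R
of `p` maps the image of d₁ into J, so φ(d₁ z) is in IJ; and φ(e) ≡ 1 modulo J, which recovers f. -/
lemma inf_le_mul_of_exact {R : Type*} [CommRing R] {I J : Ideal R} {P₀ P₁ P₂ : Type*}
    [AddCommGroup P₀] [Module R P₀] [AddCommGroup P₁] [Module R P₁] [AddCommGroup P₂] [Module R P₂]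
    [Module.Projective R P₀] (d₂ : P₂ →ₗ[R] P₁) (d₁ : P₁ →ₗ[R] P₀) (p : P₀ →ₗ[R] R ⧸ J)
    (hd : Function.Exact d₂ d₁) (hp : Function.Surjective p) (hp' : Function.Exact d₁ p)
    (h : ∀ x, d₁.lTensor (R ⧸ I) x = 0 → ∃ y, d₂.lTensor (R ⧸ I) y = x) : I ⊓ J ≤ I * J := by
  rintro f ⟨hfI, hfJ⟩
  obtain ⟨e, he⟩ := hp 1
  have h1 : p (f • e) = 0 := by
    rw [map_smul, he, Algebra.smul_def, mul_one]
    exact Ideal.Quotient.eq_zero_iff_mem.2 hfJ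
  obtain ⟨z, hz⟩ := (hp' _).1 h1
  obtain ⟨y, hy⟩ := h ((1 : R ⧸ I) ⊗ₜ z) (by
    rw [LinearMap.lTensor_tmul, hz, ← TensorProduct.smul_tmul, Algebra.smul_def, mul_one]
    have : algebraMap R (R ⧸ I) f = 0 := Ideal.Quotient.eq_zero_iff_mem.2 hfI
    rw [this, TensorProduct.zero_tmul])
  obtain ⟨w, rfl⟩ : ∃ w : P₂, (1 : R ⧸ I) ⊗ₜ[R] w = y :=
    TensorProduct.mk_surjective R P₂ (R ⧸ I) Ideal.Quotient.mk_surjective y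
  rw [LinearMap.lTensor_tmul, ← sub_eq_zero, ← TensorProduct.tmul_sub] at hy
  have h2 : d₂ w - z ∈ I • (⊤ : Submodule R P₁) := by
    rw [← Submodule.Quotient.mk_eq_zero, ← TensorProduct.quotTensorEquivQuotSMul_mk_one_tmul]
    exact (LinearEquiv.map_eq_zero_iff _).2 hy
  obtain ⟨φ, hφ⟩ :=
    Module.projective_lifting_property (Submodule.mkQ J) p (Submodule.mkQ_surjective J)
  have h3 : ∀ x, φ (d₁ x) ∈ J := by
    intro x
    rw [← Submodule.Quotient.mk_eq_zero]
    exact (LinearMap.congr_fun hφ (d₁ x)).trans ((hp' _).2 ⟨x, rfl⟩)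
  have h4 : φ (d₁ z) ∈ I * J := by
    have : φ (d₁ (d₂ w - z)) ∈ I * J := by
      refine Submodule.smul_induction_on h2 ?_ ?_
      · intro a ha x _
        rw [map_smul, map_smul, smul_eq_mul]
        exact Ideal.mul_mem_mul ha (h3 x)
      · intro x y hx hy
        rw [map_add, map_add]
        exact add_mem hx hy
    rw [map_sub, (hd _).2 ⟨w, rfl⟩, zero_sub, map_neg] at this
    exact neg_mem_iff.1 this
  have h5 : φ e - 1 ∈ J := by
    rw [← Submodule.Quotient.mk_eq_zero, Submodule.Quotient.mk_sub, sub_eq_zero]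
    exact (LinearMap.congr_fun hφ e).trans he
  have h6 : f = φ (d₁ z) - f * (φ e - 1) := by
    rw [hz, map_smul, smul_eq_mul]
    ring
  rw [h6]
  exact sub_mem h4 (Ideal.mul_mem_mul hfI h5)

lemma inf_le_mul_of_torIndependent {R : Type u} [CommRing R] {I J : Ideal R}
    (h : TorIndependent R (R ⧸ I) (R ⧸ J)) : I ⊓ J ≤ I * J := by
  let P := projectiveResolution (ModuleCat.of R (R ⧸ J))
  let F := (MonoidalCategory.tensoringLeft (ModuleCat.{u} R)).obj (ModuleCat.of R (R ⧸ I))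
  have h1 := (h 1 one_pos).of_iso (P.isoLeftDerivedObj F 1).symm
  have h2 := (HomologicalComplex.exactAt_iff_isZero_homology _ _).2 h1
  rw [HomologicalComplex.exactAt_iff' _ 2 1 0 (by simp) (by simp),
    ShortComplex.moduleCat_exact_iff] at h2
  have h3 := P.exact₀
  rw [ShortComplex.moduleCat_exact_iff] at h3
  have h4 := P.complex_exactAt_succ 0
  rw [HomologicalComplex.exactAt_iff' _ 2 1 0 (by simp) (by simp),
    ShortComplex.moduleCat_exact_iff] at h4
  have hproj : Module.Projective R (P.complex.X 0) :=
    (IsProjective.iff_projective _).2 (P.projective 0)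
  have hepi : Function.Surjective (P.π.f 0).hom :=
    (ModuleCat.epi_iff_surjective _).1 inferInstance
  refine inf_le_mul_of_exact (P.complex.d 2 1).hom (P.complex.d 1 0).hom (P.π.f 0).hom
    (fun x => ⟨h4 x, ?_⟩) hepi (fun x => ⟨h3 x, ?_⟩) h2
  · rintro ⟨y, rfl⟩
    exact LinearMap.congr_fun (congrArg ModuleCat.Hom.hom (P.complex.d_comp_d 2 1 0)) y
  · rintro ⟨y, rfl⟩
    exact LinearMap.congr_fun (congrArg ModuleCat.Hom.hom P.complex_d_comp_π_f_zero) y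

end Tor

/-! ### Rigidity and division by regular sequences of linear forms -/

section RegularSequence

universe u

variable {k : Type u} [Field k] {Q : Type u} [CommRing Q] [Algebra k Q] {𝒬 : ℕ → Submodule k Q}
  [GradedAlgebra 𝒬]

lemma proj_mem_of_isHomogeneous {I : Ideal Q} (hI : I.IsHomogeneous 𝒬) (j : ℕ) {a : Q}
    (ha : a ∈ I) : GradedRing.proj 𝒬 j a ∈ I := hI j ha

lemma mem_mul_sup_span_singleton {J P : Ideal Q} {y a : Q} (ha : a ∈ J * (P ⊔ Ideal.span {y})) :
    ∃ b ∈ J * P, ∃ c ∈ J, a = b + c * y := by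
  rw [Ideal.mul_sup] at ha
  obtain ⟨b, hb, z, hz, rfl⟩ := Submodule.mem_sup.1 ha
  obtain ⟨c, hc, rfl⟩ := Ideal.mem_mul_span_singleton.1 hz
  exact ⟨b, hb, c, hc, rfl⟩

/-- Induction on degree, in the role of Nakayama. An element of J ∩ P is b + c y with b in JP and c
in J; regularity puts c in P, so c is again in J ∩ P, and its relevant component has degree one
less. -/
lemma inf_le_mul_of_regular {J P : Ideal Q} (hJ : J.IsHomogeneous 𝒬) (hP : P.IsHomogeneous 𝒬)
    {y : Q} (hy : y ∈ 𝒬 1) (hreg : ∀ c, c * y ∈ P → c ∈ P)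
    (h : J ⊓ (P ⊔ Ideal.span {y}) ≤ J * (P ⊔ Ideal.span {y})) : J ⊓ P ≤ J * P := by
  classical
  have key : ∀ d, ∀ a ∈ 𝒬 d, a ∈ J ⊓ P → a ∈ J * P := by
    intro d
    induction d with
    | zero =>
      intro a ha haJ
      obtain ⟨b, hb, c, hc, rfl⟩ := mem_mul_sup_span_singleton
        (h ⟨haJ.1, Ideal.mem_sup_left haJ.2⟩)
      have h1 := proj_eq_self ha
      rw [map_add, proj_zero_mul one_pos c hy, add_zero] at h1
      rw [← h1]
      exact proj_mem_of_isHomogeneous (hJ.mul hP) 0 hb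
    | succ d ih =>
      intro a ha haJ
      obtain ⟨b, hb, c, hc, rfl⟩ := mem_mul_sup_span_singleton
        (h ⟨haJ.1, Ideal.mem_sup_left haJ.2⟩)
      have hcP : c ∈ P := hreg c ((Submodule.add_mem_iff_right _ (Ideal.mul_le_right hb)).1 haJ.2)
      have h1 := proj_eq_self ha
      rw [map_add, proj_succ_mul c hy] at h1
      rw [← h1]
      refine add_mem (proj_mem_of_isHomogeneous (hJ.mul hP) _ hb) (Ideal.mul_mem_right _ _ ?_)
      exact ih _ (proj_mem _ _)
        ⟨proj_mem_of_isHomogeneous hJ _ hc, proj_mem_of_isHomogeneous hP _ hcP⟩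
  intro a ha
  rw [← DirectSum.sum_support_decompose 𝒬 a]
  exact sum_mem fun d _ => key d _ (SetLike.coe_mem _) ⟨hJ d ha.1, hP d ha.2⟩

-- If c y = a + p with a in J and p in P, then a lies in J ∩ (P + (y)), so a = b + c' y with b in JP
-- and c' in J. Then (c - c') y is in P, and regularity of y modulo P gives c ≡ c' modulo P.
omit [Algebra k Q] in
lemma mem_sup_of_mul_mem_sup {J P : Ideal Q} {y : Q} (hreg : ∀ c, c * y ∈ P → c ∈ P)
    (h : J ⊓ (P ⊔ Ideal.span {y}) ≤ J * (P ⊔ Ideal.span {y})) (c : Q) (hc : c * y ∈ J ⊔ P) :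
    c ∈ J ⊔ P := by
  obtain ⟨a, ha, p, hp, e⟩ := Submodule.mem_sup.1 hc
  have h1 : a = c * y - p := by rw [← e]; ring
  have h2 : a ∈ P ⊔ Ideal.span {y} := by
    rw [h1]
    exact Submodule.sub_mem _
      (Ideal.mem_sup_right (Ideal.mul_mem_left _ _ (Ideal.mem_span_singleton_self y)))
      (Ideal.mem_sup_left hp)
  obtain ⟨b, hb, c', hc', e'⟩ := mem_mul_sup_span_singleton (h ⟨ha, h2⟩)
  have h3 : c - c' ∈ P := hreg _ <| by
    have : (c - c') * y = b + p := by linear_combination e' - e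
    rw [this]
    exact add_mem (Ideal.mul_le_right hb) hp
  rw [← sub_add_cancel c c']
  exact add_mem (Ideal.mem_sup_right h3) (Ideal.mem_sup_left hc')

omit [GradedAlgebra 𝒬] in
lemma mem_imageGrading_iff_of_comp {C D : Type u} [CommRing C] [Algebra k C] [CommRing D]
    [Algebra k D] {π : Q →ₐ[k] C} {π' : Q →ₐ[k] D} {f : C →ₐ[k] D} (h : ∀ q, f (π q) = π' q)
    (j : ℕ) (a : D) : a ∈ imageGrading 𝒬 π' j ↔ ∃ c ∈ imageGrading 𝒬 π j, f c = a := by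
  constructor
  · rintro ⟨q, hq, rfl⟩
    exact ⟨π q, ⟨q, hq, rfl⟩, h q⟩
  · rintro ⟨_, ⟨q, hq, rfl⟩, rfl⟩
    exact ⟨q, hq, (h q).symm⟩

lemma ker_mkₐ_isHomogeneous {K : Ideal Q} (hK : K.IsHomogeneous 𝒬) :
    (RingHom.ker (Ideal.Quotient.mkₐ k K)).IsHomogeneous 𝒬 := by
  have : RingHom.ker (Ideal.Quotient.mkₐ k K) = K := Ideal.Quotient.mkₐ_ker k K
  rwa [this]

lemma isKoszul_quotient_iff_sup_span_singleton (h0 : 𝒬 0 = 1) {K : Ideal Q}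
    (hK : K.IsHomogeneous 𝒬) {y : Q} (hy : y ∈ 𝒬 1) (htop : K ⊔ Ideal.span {y} ≠ ⊤)
    (hreg : ∀ c, c * y ∈ K → c ∈ K) :
    IsKoszul (imageGrading 𝒬 (Ideal.Quotient.mkₐ k K)) ↔
      IsKoszul (imageGrading 𝒬 (Ideal.Quotient.mkₐ k (K ⊔ Ideal.span {y}))) := by
  have hK' : (K ⊔ Ideal.span {y}).IsHomogeneous 𝒬 :=
    hK.sup (Ideal.homogeneous_span _ _ (by rintro _ rfl; exact ⟨1, hy⟩))
  let := imageGradedAlgebra (Ideal.Quotient.mkₐ_surjective k K) (ker_mkₐ_isHomogeneous hK)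
  let := imageGradedAlgebra (Ideal.Quotient.mkₐ_surjective k _) (ker_mkₐ_isHomogeneous hK')
  have : Nontrivial (Q ⧸ (K ⊔ Ideal.span {y})) := Ideal.Quotient.nontrivial_iff.2 htop
  refine isKoszul_iff_of_regular (Ideal.Quotient.factorₐ k le_sup_left) (imageGrading_zero h0)
    (imageGrading_zero h0) (mem_imageGrading_iff_of_comp fun q => rfl)
    (l := Ideal.Quotient.mkₐ k K y) ⟨y, hy, rfl⟩ ?_ ?_
  · intro c
    obtain ⟨q, rfl⟩ := Ideal.Quotient.mk_surjective c
    intro h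
    exact Ideal.Quotient.eq_zero_iff_mem.2 (hreg q (Ideal.Quotient.eq_zero_iff_mem.1 h))
  · intro c
    obtain ⟨q, rfl⟩ := Ideal.Quotient.mk_surjective c
    refine (Ideal.Quotient.eq_zero_iff_mem (I := K ⊔ Ideal.span {y}) (a := q)).trans ?_
    rw [Submodule.mem_sup]
    constructor
    · rintro ⟨a, ha, z, hz, rfl⟩
      obtain ⟨p, rfl⟩ := Ideal.mem_span_singleton'.1 hz
      refine ⟨Ideal.Quotient.mk K p, ?_⟩
      rw [map_add, Ideal.Quotient.eq_zero_iff_mem.2 ha, zero_add, map_mul]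
      rfl
    · rintro ⟨p, hp⟩
      obtain ⟨p, rfl⟩ := Ideal.Quotient.mk_surjective p
      exact ⟨q - p * y, Ideal.Quotient.eq.1 (hp.symm.trans (map_mul _ _ _).symm), p * y,
        Ideal.mem_span_singleton'.2 ⟨p, rfl⟩, sub_add_cancel _ _⟩

lemma isKoszul_quotient_iff_of_ker (h0 : 𝒬 0 = 1) {K : Ideal Q} (hK : K.IsHomogeneous 𝒬)
    {C : Type u} [CommRing C] [Algebra k C] [Nontrivial C] {π : Q →ₐ[k] C}
    (hπ : Function.Surjective π) (hker : ∀ q, π q = 0 ↔ q ∈ K) :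
    IsKoszul (imageGrading 𝒬 (Ideal.Quotient.mkₐ k K)) ↔ IsKoszul (imageGrading 𝒬 π) := by
  have e : RingHom.ker π = K := Ideal.ext hker
  let := imageGradedAlgebra (Ideal.Quotient.mkₐ_surjective k K) (ker_mkₐ_isHomogeneous hK)
  let := imageGradedAlgebra hπ (e ▸ hK)
  refine isKoszul_iff_of_injective (Ideal.Quotient.liftₐ K π fun q => (hker q).2)
    (imageGrading_zero h0) (imageGrading_zero h0) (mem_imageGrading_iff_of_comp fun q => rfl) ?_
  rw [injective_iff_map_eq_zero]
  intro c
  obtain ⟨q, rfl⟩ := Ideal.Quotient.mk_surjective c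
  exact fun h => Ideal.Quotient.eq_zero_iff_mem.2 ((hker q).1 h)

/-- Koszulness of quotients is preserved under division by a sequence `y` of linear forms that is
regular on the ambient ring and Tor-independent from the ideal `J`. -/
lemma isKoszul_quotient_iff_sup_span (h0 : 𝒬 0 = 1) {J : Ideal Q} (hJ : J.IsHomogeneous 𝒬)
    {y : ℕ → Q} (hy : ∀ i, y i ∈ 𝒬 1) {n : ℕ}
    (hreg : ∀ j < n, ∀ c, c * y j ∈ Ideal.span (y '' Set.Iio j) → c ∈ Ideal.span (y '' Set.Iio j))
    (htop : J ⊔ Ideal.span (y '' Set.Iio n) ≠ ⊤)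
    (h : J ⊓ Ideal.span (y '' Set.Iio n) ≤ J * Ideal.span (y '' Set.Iio n)) :
    IsKoszul (imageGrading 𝒬 (Ideal.Quotient.mkₐ k J)) ↔
      IsKoszul (imageGrading 𝒬 (Ideal.Quotient.mkₐ k (J ⊔ Ideal.span (y '' Set.Iio n)))) := by
  induction n with
  | zero =>
    have : J ⊔ Ideal.span (y '' Set.Iio 0) = J := by simp
    rw [this]
  | succ n ih =>
    have hs : Ideal.span (y '' Set.Iio (n + 1)) =
        Ideal.span (y '' Set.Iio n) ⊔ Ideal.span {y n} := by
      have : Set.Iio (n + 1) = insert n (Set.Iio n) := by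
        ext i
        simp [le_iff_eq_or_lt]
      rw [this, Set.image_insert_eq, Ideal.span_insert, sup_comm]
    have hP : (Ideal.span (y '' Set.Iio n)).IsHomogeneous 𝒬 :=
      Ideal.homogeneous_span _ _ (by rintro _ ⟨i, -, rfl⟩; exact ⟨1, hy i⟩)
    rw [hs] at htop h ⊢
    rw [← sup_assoc] at htop ⊢
    -- Rigidity hands the intersection condition down to the shorter sequence; the last form is then
    -- regular on the quotient by `J` and the earlier forms.
    rw [ih (fun j hj => hreg j (by lia)) (fun ht => htop (by rw [ht, top_sup_eq]))
      (inf_le_mul_of_regular hJ hP (hy n) (hreg n n.lt_succ_self) h)]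
    exact isKoszul_quotient_iff_sup_span_singleton h0 (hJ.sup hP) (hy n) htop
      (mem_sup_of_mul_mem_sup (hreg n n.lt_succ_self) h)

end RegularSequence

/-! ### The diagonal ideal of k[x, z] -/

section Diagonal

universe u

variable {k : Type u} [Field k] {n : ℕ}

/-- The linear forms `xᵢ - zᵢ` in `k[x, z]`. -/
noncomputable def diagonalForm (k : Type u) [Field k] (n : ℕ) (i : ℕ) :
    MvPolynomial (Fin n ⊕ Fin n) k :=
  if h : i < n then X (.inl ⟨i, h⟩) - X (.inr ⟨i, h⟩) else 0

/-- The ideal generated by the forms `xᵢ - zᵢ` for `i < j`. -/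
noncomputable def diagonalIdeal (k : Type u) [Field k] (n j : ℕ) :
    Ideal (MvPolynomial (Fin n ⊕ Fin n) k) :=
  Ideal.span (diagonalForm k n '' Set.Iio j)

lemma diagonalForm_mem (i : ℕ) :
    diagonalForm k n i ∈ homogeneousSubmodule (Fin n ⊕ Fin n) k 1 := by
  unfold diagonalForm
  split_ifs with h
  · exact sub_mem (isHomogeneous_X _ _) (isHomogeneous_X _ _)
  · exact zero_mem _

lemma sub_apply_mem_of_X {σ : Type*} {P : Ideal (MvPolynomial σ k)}
    (φ : MvPolynomial σ k →ₐ[k] MvPolynomial σ k) (h : ∀ s, X s - φ (X s) ∈ P)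
    (q : MvPolynomial σ k) : q - φ q ∈ P := by
  have : Ideal.Quotient.mkₐ k P = (Ideal.Quotient.mkₐ k P).comp φ :=
    MvPolynomial.algHom_ext fun s => Ideal.Quotient.eq.2 (h s)
  exact Ideal.Quotient.eq.1 (DFunLike.congr_fun this q)

lemma X_inl_sub_X_inr_mem {j : ℕ} {i : Fin n} (h : i.1 < j) :
    (X (.inl i) - X (.inr i) : MvPolynomial (Fin n ⊕ Fin n) k) ∈ diagonalIdeal k n j :=
  Ideal.subset_span ⟨i.1, h, by simp [diagonalForm]⟩

/-- The substitution `θ` of xᵢ for zᵢ, i < j, kills the ideal and is the identity modulo it. It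
keeps the next form nonzero, so the claim reduces to k[x, z] being a domain. -/
lemma mem_diagonalIdeal_of_mul_mem {j : ℕ} (hj : j < n) (c : MvPolynomial (Fin n ⊕ Fin n) k)
    (hc : c * diagonalForm k n j ∈ diagonalIdeal k n j) : c ∈ diagonalIdeal k n j := by
  let θ : MvPolynomial (Fin n ⊕ Fin n) k →ₐ[k] MvPolynomial (Fin n ⊕ Fin n) k :=
    aeval (Sum.elim (fun i => X (.inl i)) fun i => if i.1 < j then X (.inl i) else X (.inr i))
  have hθ : ∀ q, q - θ q ∈ diagonalIdeal k n j := by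
    refine sub_apply_mem_of_X θ ?_
    rintro (i | i)
    · simp [θ]
    · simp only [θ, aeval_X, Sum.elim_inr]
      split_ifs with h
      · rw [← neg_mem_iff, neg_sub]
        exact X_inl_sub_X_inr_mem h
      · simp
  have hker : diagonalIdeal k n j ≤ RingHom.ker θ := by
    refine Ideal.span_le.2 ?_
    rintro _ ⟨i, hi, rfl⟩
    have hi' : i < j := hi
    simp [diagonalForm, hi'.trans hj, θ, hi']
  have h1 : θ c * θ (diagonalForm k n j) = 0 := by
    rw [← map_mul]
    exact hker hc
  have h2 : θ (diagonalForm k n j) ≠ 0 := by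
    simp only [diagonalForm, hj, dif_pos, θ, map_sub, aeval_X, Sum.elim_inl, Sum.elim_inr,
      lt_irrefl, if_false]
    rw [sub_ne_zero]
    exact fun h => by simpa using X_injective h
  have h3 := hθ c
  rwa [(mul_eq_zero.1 h1).resolve_right h2, sub_zero] at h3

/-- The multiplication map `k[x, z] → k[x]`. -/
noncomputable def diagonalMap (k : Type u) [Field k] (n : ℕ) :
    MvPolynomial (Fin n ⊕ Fin n) k →ₐ[k] MvPolynomial (Fin n) k :=
  rename (Sum.elim id id)

@[simp] lemma diagonalMap_rename_inl (p : MvPolynomial (Fin n) k) :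
    diagonalMap k n (rename Sum.inl p) = p := by
  rw [diagonalMap, rename_rename]
  exact rename_id_apply p

@[simp] lemma diagonalMap_rename_inr (p : MvPolynomial (Fin n) k) :
    diagonalMap k n (rename Sum.inr p) = p := by
  rw [diagonalMap, rename_rename]
  exact rename_id_apply p

lemma diagonalMap_eq_zero {q : MvPolynomial (Fin n ⊕ Fin n) k} (hq : q ∈ diagonalIdeal k n n) :
    diagonalMap k n q = 0 := by
  have : diagonalIdeal k n n ≤ RingHom.ker (diagonalMap k n) := by
    refine Ideal.span_le.2 ?_
    rintro _ ⟨i, hi, rfl⟩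
    have hi' : i < n := hi
    simp [diagonalForm, hi', diagonalMap]
  exact this hq

lemma sub_rename_inl_mem (q : MvPolynomial (Fin n ⊕ Fin n) k) :
    q - rename Sum.inl (diagonalMap k n q) ∈ diagonalIdeal k n n := by
  refine sub_apply_mem_of_X ((rename Sum.inl).comp (diagonalMap k n)) ?_ q
  rintro (i | i)
  · simp [diagonalMap]
  · rw [← neg_mem_iff, neg_sub]
    simpa [diagonalMap] using X_inl_sub_X_inr_mem i.2

lemma sub_rename_inr_mem (q : MvPolynomial (Fin n ⊕ Fin n) k) :
    q - rename Sum.inr (diagonalMap k n q) ∈ diagonalIdeal k n n := by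
  refine sub_apply_mem_of_X ((rename Sum.inr).comp (diagonalMap k n)) ?_ q
  rintro (i | i)
  · simpa [diagonalMap] using X_inl_sub_X_inr_mem i.2
  · simp [diagonalMap]

lemma rename_inl_sub_rename_inr_mem (p : MvPolynomial (Fin n) k) :
    rename Sum.inl p - rename Sum.inr p ∈ diagonalIdeal k n n := by
  simpa using sub_rename_inr_mem (rename Sum.inl p)

/-- The ideal `I₁(x) + I₂(z)` of `k[x, z]`. -/
noncomputable def sumIdeal (I₁ I₂ : Ideal (MvPolynomial (Fin n) k)) :
    Ideal (MvPolynomial (Fin n ⊕ Fin n) k) :=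
  I₁.map (rename Sum.inl : MvPolynomial (Fin n) k →ₐ[k] _) ⊔
    I₂.map (rename Sum.inr : MvPolynomial (Fin n) k →ₐ[k] _)

variable {I₁ I₂ : Ideal (MvPolynomial (Fin n) k)}

lemma rename_inl_mem_sumIdeal {p : MvPolynomial (Fin n) k} (hp : p ∈ I₁) :
    rename Sum.inl p ∈ sumIdeal I₁ I₂ := Ideal.mem_sup_left (Ideal.mem_map_of_mem _ hp)

lemma rename_inr_mem_sumIdeal {p : MvPolynomial (Fin n) k} (hp : p ∈ I₂) :
    rename Sum.inr p ∈ sumIdeal I₁ I₂ := Ideal.mem_sup_right (Ideal.mem_map_of_mem _ hp)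

lemma map_rename_isHomogeneous {I : Ideal (MvPolynomial (Fin n) k)}
    (hI : I.IsHomogeneous (homogeneousSubmodule (Fin n) k)) (f : Fin n → Fin n ⊕ Fin n) :
    (I.map (rename f : MvPolynomial (Fin n) k →ₐ[k] _)).IsHomogeneous
      (homogeneousSubmodule (Fin n ⊕ Fin n) k) := by
  obtain ⟨S, rfl⟩ := (Ideal.IsHomogeneous.iff_exists _ I).1 hI
  rw [Ideal.map_span]
  refine Ideal.homogeneous_span _ _ ?_
  rintro _ ⟨_, ⟨⟨p, i, hp⟩, -, rfl⟩, rfl⟩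
  exact ⟨i, IsHomogeneous.rename_isHomogeneous hp⟩

lemma sumIdeal_isHomogeneous (h₁ : I₁.IsHomogeneous (homogeneousSubmodule (Fin n) k))
    (h₂ : I₂.IsHomogeneous (homogeneousSubmodule (Fin n) k)) :
    (sumIdeal I₁ I₂).IsHomogeneous (homogeneousSubmodule (Fin n ⊕ Fin n) k) :=
  (map_rename_isHomogeneous h₁ _).sup (map_rename_isHomogeneous h₂ _)

lemma diagonalMap_mem_of_mem_map_inl {q : MvPolynomial (Fin n ⊕ Fin n) k}
    {I : Ideal (MvPolynomial (Fin n) k)}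
    (hq : q ∈ I.map (rename Sum.inl : MvPolynomial (Fin n) k →ₐ[k] _)) :
    diagonalMap k n q ∈ I := by
  have : I.map (rename Sum.inl : MvPolynomial (Fin n) k →ₐ[k] _) ≤
      I.comap (diagonalMap k n) := by
    rw [Ideal.map_le_iff_le_comap]
    intro p hp
    simpa using hp
  exact this hq

lemma diagonalMap_mem_of_mem_map_inr {q : MvPolynomial (Fin n ⊕ Fin n) k}
    {I : Ideal (MvPolynomial (Fin n) k)}
    (hq : q ∈ I.map (rename Sum.inr : MvPolynomial (Fin n) k →ₐ[k] _)) :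
    diagonalMap k n q ∈ I := by
  have : I.map (rename Sum.inr : MvPolynomial (Fin n) k →ₐ[k] _) ≤
      I.comap (diagonalMap k n) := by
    rw [Ideal.map_le_iff_le_comap]
    intro p hp
    simpa using hp
  exact this hq

/-- If `I₁ ∩ I₂ = I₁ I₂`, then `I₁(x) + I₂(z)` is Tor-independent from the diagonal. -/
lemma sumIdeal_inf_diagonalIdeal_le (h : I₁ ⊓ I₂ ≤ I₁ * I₂) :
    sumIdeal I₁ I₂ ⊓ diagonalIdeal k n n ≤ sumIdeal I₁ I₂ * diagonalIdeal k n n := by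
  -- Modulo JD, an element s(x, z) of the extension of I₁ may be replaced by s(x, x): true on
  -- generators, and a product rule handles coefficients.
  have hl : ∀ s ∈ I₁.map (rename Sum.inl : MvPolynomial (Fin n) k →ₐ[k] _),
      s - rename Sum.inl (diagonalMap k n s) ∈ sumIdeal I₁ I₂ * diagonalIdeal k n n := by
    intro s hs
    induction hs using Submodule.span_induction with
    | mem x hx =>
      obtain ⟨p, -, rfl⟩ := hx
      have : (rename Sum.inl p : MvPolynomial (Fin n ⊕ Fin n) k) -
          rename Sum.inl (diagonalMap k n (rename Sum.inl p)) = 0 := by simp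
      exact this ▸ zero_mem _
    | zero => simp
    | add x y _ _ hx hy =>
      rw [map_add, map_add, add_sub_add_comm]
      exact add_mem hx hy
    | smul a x hx ih =>
      have : a • x - rename Sum.inl (diagonalMap k n (a • x)) =
          x * (a - rename Sum.inl (diagonalMap k n a)) +
            rename Sum.inl (diagonalMap k n a) * (x - rename Sum.inl (diagonalMap k n x)) := by
        simp only [smul_eq_mul, map_mul]
        ring
      rw [this]
      exact add_mem (Ideal.mul_mem_mul (Ideal.mem_sup_left hx) (sub_rename_inl_mem a))
        (Ideal.mul_mem_left _ _ ih)
  have hr : ∀ s ∈ I₂.map (rename Sum.inr : MvPolynomial (Fin n) k →ₐ[k] _),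
      s - rename Sum.inr (diagonalMap k n s) ∈ sumIdeal I₁ I₂ * diagonalIdeal k n n := by
    intro s hs
    induction hs using Submodule.span_induction with
    | mem x hx =>
      obtain ⟨p, -, rfl⟩ := hx
      have : (rename Sum.inr p : MvPolynomial (Fin n ⊕ Fin n) k) -
          rename Sum.inr (diagonalMap k n (rename Sum.inr p)) = 0 := by simp
      exact this ▸ zero_mem _
    | zero => simp
    | add x y _ _ hx hy =>
      rw [map_add, map_add, add_sub_add_comm]
      exact add_mem hx hy
    | smul a x hx ih =>
      have : a • x - rename Sum.inr (diagonalMap k n (a • x)) =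
          x * (a - rename Sum.inr (diagonalMap k n a)) +
            rename Sum.inr (diagonalMap k n a) * (x - rename Sum.inr (diagonalMap k n x)) := by
        simp only [smul_eq_mul, map_mul]
        ring
      rw [this]
      exact add_mem (Ideal.mul_mem_mul (Ideal.mem_sup_right hx) (sub_rename_inr_mem a))
        (Ideal.mul_mem_left _ _ ih)
  -- For f = pq, f(x) - f(z) = p(x)(q(x) - q(z)) + q(z)(p(x) - p(z)), and both p(x) and q(z) lie in
  -- J. This is why a product, not just an intersection, is needed.
  have hlr : ∀ f ∈ I₁ * I₂, rename Sum.inl f - rename Sum.inr f ∈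
      sumIdeal I₁ I₂ * diagonalIdeal k n n := by
    intro f hf
    refine Submodule.mul_induction_on hf ?_ ?_
    · intro p hp q hq
      have : (rename Sum.inl (p * q) : MvPolynomial (Fin n ⊕ Fin n) k) - rename Sum.inr (p * q) =
          rename Sum.inl p * (rename Sum.inl q - rename Sum.inr q) +
            rename Sum.inr q * (rename Sum.inl p - rename Sum.inr p) := by
        simp only [map_mul]
        ring
      rw [this]
      exact add_mem
        (Ideal.mul_mem_mul (rename_inl_mem_sumIdeal hp) (rename_inl_sub_rename_inr_mem q))
        (Ideal.mul_mem_mul (rename_inr_mem_sumIdeal hq) (rename_inl_sub_rename_inr_mem p))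
    · intro x y hx hy
      rw [map_add, map_add, add_sub_add_comm]
      exact add_mem hx hy
  rintro u ⟨huJ, huP⟩
  obtain ⟨s, hs, t, ht, rfl⟩ := Submodule.mem_sup.1 huJ
  have h0 := diagonalMap_eq_zero huP
  rw [map_add] at h0
  -- On the diagonal s + t vanishes, so the restriction of s equals minus that of t and lies in both
  -- ideals.
  have hf : diagonalMap k n s ∈ I₁ * I₂ := by
    refine h ⟨diagonalMap_mem_of_mem_map_inl hs, ?_⟩
    rw [eq_neg_of_add_eq_zero_left h0]
    exact neg_mem (diagonalMap_mem_of_mem_map_inr ht)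
  have e : s + t = (s - rename Sum.inl (diagonalMap k n s)) +
      (t - rename Sum.inr (diagonalMap k n t)) +
        (rename Sum.inl (diagonalMap k n s) - rename Sum.inr (diagonalMap k n s)) := by
    rw [eq_neg_of_add_eq_zero_right h0, map_neg]
    ring
  rw [e]
  exact add_mem (add_mem (hl s hs) (hr t ht)) (hlr _ hf)

/-- Identifies Q/(J + D) with R/(I₁ + I₂): modulo D, x and z may be exchanged freely. -/
lemma diagonalMap_mem_sup_iff (q : MvPolynomial (Fin n ⊕ Fin n) k) :
    diagonalMap k n q ∈ I₁ ⊔ I₂ ↔ q ∈ sumIdeal I₁ I₂ ⊔ diagonalIdeal k n n := by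
  constructor
  · intro h
    rw [← sub_add_cancel q (rename Sum.inl (diagonalMap k n q))]
    refine add_mem (Ideal.mem_sup_right (sub_rename_inl_mem q)) ?_
    obtain ⟨a, ha, b, hb, e⟩ := Submodule.mem_sup.1 h
    rw [← e, map_add]
    refine add_mem (Ideal.mem_sup_left (rename_inl_mem_sumIdeal ha)) ?_
    rw [← sub_add_cancel (rename Sum.inl b) (rename Sum.inr b)]
    exact add_mem (Ideal.mem_sup_right (rename_inl_sub_rename_inr_mem b))
      (Ideal.mem_sup_left (rename_inr_mem_sumIdeal hb))
  · intro h
    obtain ⟨a, ha, b, hb, rfl⟩ := Submodule.mem_sup.1 h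
    obtain ⟨s, hs, t, ht, rfl⟩ := Submodule.mem_sup.1 ha
    rw [map_add, map_add, diagonalMap_eq_zero hb, add_zero]
    exact add_mem (Ideal.mem_sup_left (diagonalMap_mem_of_mem_map_inl hs))
      (Ideal.mem_sup_right (diagonalMap_mem_of_mem_map_inr ht))

end Diagonal

/-! ### Presentations of both tensor products by k[x, z], and the theorem -/

section Main

universe u

variable {k : Type u} [Field k] {n : ℕ} {I₁ I₂ : Ideal (MvPolynomial (Fin n) k)}

/-- The constant term is a homogeneous component, so it lies in `I`; a nonzero one would be a unit.
-/
lemma constantCoeff_eq_zero_of_mem {I : Ideal (MvPolynomial (Fin n) k)}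
    (hI : I.IsHomogeneous (homogeneousSubmodule (Fin n) k)) (hI' : I ≠ ⊤)
    {p : MvPolynomial (Fin n) k} (hp : p ∈ I) : constantCoeff p = 0 := by
  by_contra h
  have h1 : homogeneousComponent 0 p ∈ I := by
    rw [← decomposition.decompose'_apply]
    exact hI 0 hp
  rw [homogeneousComponent_zero] at h1
  exact hI' (Ideal.eq_top_of_isUnit_mem _ h1 ((isUnit_iff_ne_zero.2 h).map C))

/-- The augmentation of a quotient of the polynomial ring by a proper homogeneous ideal. -/
noncomputable def quotientAugmentation {I : Ideal (MvPolynomial (Fin n) k)}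
    (hI : I.IsHomogeneous (homogeneousSubmodule (Fin n) k)) (hI' : I ≠ ⊤) :
    (MvPolynomial (Fin n) k ⧸ I) →ₐ[k] k :=
  Ideal.Quotient.liftₐ I (aeval 0) fun p hp => by
    rw [aeval_zero, constantCoeff_eq_zero_of_mem hI hI' hp, map_zero]

/-- The structure map of a quotient of `k[x]`, regarded as a quotient of `k[x, z]`. -/
noncomputable def diagonalQuotientMap (k : Type u) [Field k] (n : ℕ) (S : Type u) [CommRing S]
    [Algebra k S] [Algebra (MvPolynomial (Fin n) k) S]
    [IsScalarTower k (MvPolynomial (Fin n) k) S] : MvPolynomial (Fin n ⊕ Fin n) k →ₐ[k] S :=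
  (IsScalarTower.toAlgHom k (MvPolynomial (Fin n) k) S).comp (diagonalMap k n)

lemma imageGrading_diagonalQuotientMap (S : Type u) [CommRing S]
    [Algebra k S] [Algebra (MvPolynomial (Fin n) k) S]
    [IsScalarTower k (MvPolynomial (Fin n) k) S] :
    imageGrading (homogeneousSubmodule (Fin n ⊕ Fin n) k) (diagonalQuotientMap k n S) =
      gradingFromPolynomialRing k n S := by
  ext j s
  constructor
  · rintro ⟨q, hq, rfl⟩
    exact ⟨diagonalMap k n q, IsHomogeneous.rename_isHomogeneous hq, rfl⟩
  · rintro ⟨p, hp, rfl⟩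
    refine ⟨rename Sum.inl p, IsHomogeneous.rename_isHomogeneous hp, ?_⟩
    change algebraMap _ S (diagonalMap k n (rename Sum.inl p)) = algebraMap _ S p
    rw [diagonalMap_rename_inl]

lemma isKoszul_gradingFromPolynomialRing_iff
    (h₁ : I₁.IsHomogeneous (homogeneousSubmodule (Fin n) k))
    (h₂ : I₂.IsHomogeneous (homogeneousSubmodule (Fin n) k))
    (S : Type u) [CommRing S] [Nontrivial S] [Algebra k S] [Algebra (MvPolynomial (Fin n) k) S]
    [IsScalarTower k (MvPolynomial (Fin n) k) S]
    (hS : Function.Surjective (algebraMap (MvPolynomial (Fin n) k) S))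
    (hker : ∀ p, algebraMap (MvPolynomial (Fin n) k) S p = 0 ↔ p ∈ I₁ ⊔ I₂) :
    IsKoszul (imageGrading (homogeneousSubmodule (Fin n ⊕ Fin n) k)
      (Ideal.Quotient.mkₐ k (sumIdeal I₁ I₂ ⊔ diagonalIdeal k n n))) ↔
        IsKoszul (gradingFromPolynomialRing k n S) := by
  rw [← imageGrading_diagonalQuotientMap]
  refine isKoszul_quotient_iff_of_ker (homogeneousSubmodule_zero _)
    ((sumIdeal_isHomogeneous h₁ h₂).sup (Ideal.homogeneous_span _ _ ?_)) ?_ fun q =>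
      (hker _).trans (diagonalMap_mem_sup_iff q)
  · rintro _ ⟨i, -, rfl⟩
    exact ⟨1, diagonalForm_mem i⟩
  · exact hS.comp fun p => ⟨rename Sum.inl p, diagonalMap_rename_inl p⟩

/-- The presentation of `R/I₁ ⊗ₖ R/I₂` as a quotient of `k[x, z]`. -/
noncomputable def tensorPresentation (I₁ I₂ : Ideal (MvPolynomial (Fin n) k)) :
    MvPolynomial (Fin n ⊕ Fin n) k →ₐ[k]
      (MvPolynomial (Fin n) k ⧸ I₁) ⊗[k] (MvPolynomial (Fin n) k ⧸ I₂) :=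
  aeval (Sum.elim (fun i => Ideal.Quotient.mk I₁ (X i) ⊗ₜ[k] 1)
    fun i => 1 ⊗ₜ[k] Ideal.Quotient.mk I₂ (X i))

lemma tensorPresentation_rename_inl (p : MvPolynomial (Fin n) k) :
    tensorPresentation I₁ I₂ (rename Sum.inl p) = Ideal.Quotient.mk I₁ p ⊗ₜ 1 := by
  have : (tensorPresentation I₁ I₂).comp (rename Sum.inl) =
      (Algebra.TensorProduct.includeLeft (R := k) (S := k)).comp (Ideal.Quotient.mkₐ k I₁) :=
    MvPolynomial.algHom_ext fun i => by simp [tensorPresentation]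
  exact DFunLike.congr_fun this p

lemma tensorPresentation_rename_inr (p : MvPolynomial (Fin n) k) :
    tensorPresentation I₁ I₂ (rename Sum.inr p) = 1 ⊗ₜ Ideal.Quotient.mk I₂ p := by
  have : (tensorPresentation I₁ I₂).comp (rename Sum.inr) =
      Algebra.TensorProduct.includeRight.comp (Ideal.Quotient.mkₐ k I₂) :=
    MvPolynomial.algHom_ext fun i => by simp [tensorPresentation]
  exact DFunLike.congr_fun this p

lemma tensorPresentation_surjective : Function.Surjective (tensorPresentation I₁ I₂) := by
  intro c
  induction c using TensorProduct.induction_on with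
  | zero => exact ⟨0, map_zero _⟩
  | tmul a b =>
    obtain ⟨p, rfl⟩ := Ideal.Quotient.mk_surjective a
    obtain ⟨q, rfl⟩ := Ideal.Quotient.mk_surjective b
    exact ⟨rename Sum.inl p * rename Sum.inr q, by
      rw [map_mul, tensorPresentation_rename_inl, tensorPresentation_rename_inr]; simp⟩
  | add x y hx hy =>
    obtain ⟨p, rfl⟩ := hx
    obtain ⟨q, rfl⟩ := hy
    exact ⟨p + q, map_add _ _ _⟩

lemma tensorPresentation_eq_zero_iff (q : MvPolynomial (Fin n ⊕ Fin n) k) :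
    tensorPresentation I₁ I₂ q = 0 ↔ q ∈ sumIdeal I₁ I₂ := by
  constructor
  · intro h
    -- A map back to Q/J that composes with the presentation to the quotient map, so the kernel is
    -- no larger than J.
    let ψ : (MvPolynomial (Fin n) k ⧸ I₁) ⊗[k] (MvPolynomial (Fin n) k ⧸ I₂) →ₐ[k]
        (MvPolynomial (Fin n ⊕ Fin n) k ⧸ sumIdeal I₁ I₂) :=
      Algebra.TensorProduct.lift
        (Ideal.Quotient.liftₐ I₁ ((Ideal.Quotient.mkₐ k _).comp (rename Sum.inl)) fun p hp =>
          Ideal.Quotient.eq_zero_iff_mem.2 (rename_inl_mem_sumIdeal hp))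
        (Ideal.Quotient.liftₐ I₂ ((Ideal.Quotient.mkₐ k _).comp (rename Sum.inr)) fun p hp =>
          Ideal.Quotient.eq_zero_iff_mem.2 (rename_inr_mem_sumIdeal hp))
        (fun _ _ => Commute.all _ _)
    have hψ : ψ.comp (tensorPresentation I₁ I₂) = Ideal.Quotient.mkₐ k (sumIdeal I₁ I₂) := by
      refine MvPolynomial.algHom_ext ?_
      rintro (i | i)
      · simp only [ψ, tensorPresentation, AlgHom.comp_apply, aeval_X, Sum.elim_inl,
          Algebra.TensorProduct.lift_tmul, map_one, mul_one]
        exact congrArg (Ideal.Quotient.mk _) (rename_X _ _)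
      · simp only [ψ, tensorPresentation, AlgHom.comp_apply, aeval_X, Sum.elim_inr,
          Algebra.TensorProduct.lift_tmul, map_one, one_mul]
        exact congrArg (Ideal.Quotient.mk _) (rename_X _ _)
    have h1 := DFunLike.congr_fun hψ q
    rw [AlgHom.comp_apply, h, map_zero] at h1
    exact Ideal.Quotient.eq_zero_iff_mem.1 h1.symm
  · intro h
    have : sumIdeal I₁ I₂ ≤ RingHom.ker (tensorPresentation I₁ I₂) := by
      refine sup_le (Ideal.map_le_iff_le_comap.2 ?_) (Ideal.map_le_iff_le_comap.2 ?_)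
      · intro p hp
        change tensorPresentation I₁ I₂ (rename Sum.inl p) = 0
        rw [tensorPresentation_rename_inl, Ideal.Quotient.eq_zero_iff_mem.2 hp,
          TensorProduct.zero_tmul]
      · intro p hp
        change tensorPresentation I₁ I₂ (rename Sum.inr p) = 0
        rw [tensorPresentation_rename_inr, Ideal.Quotient.eq_zero_iff_mem.2 hp,
          TensorProduct.tmul_zero]
    exact this h

/-- The quotient of the polynomial ring by a homogeneous ideal is a graded algebra. -/
@[reducible] noncomputable def gradedAlgebraQuotient {I : Ideal (MvPolynomial (Fin n) k)}
    (hI : I.IsHomogeneous (homogeneousSubmodule (Fin n) k)) :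
    GradedAlgebra (gradingFromPolynomialRing k n (MvPolynomial (Fin n) k ⧸ I)) :=
  imageGradedAlgebra
    (π := IsScalarTower.toAlgHom k (MvPolynomial (Fin n) k) (MvPolynomial (Fin n) k ⧸ I))
    Ideal.Quotient.mk_surjective (by
      have : RingHom.ker (IsScalarTower.toAlgHom k (MvPolynomial (Fin n) k)
          (MvPolynomial (Fin n) k ⧸ I)) = I := Ideal.ext fun p => Ideal.Quotient.eq_zero_iff_mem
      rwa [this])

lemma quotientAugmentation_eq_zero {I : Ideal (MvPolynomial (Fin n) k)}
    (hI : I.IsHomogeneous (homogeneousSubmodule (Fin n) k)) (hI' : I ≠ ⊤) {i : ℕ} (hi : 0 < i)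
    {a : MvPolynomial (Fin n) k ⧸ I} (ha : a ∈ gradingFromPolynomialRing k n _ i) :
    quotientAugmentation hI hI' a = 0 := by
  obtain ⟨p, hp, rfl⟩ := ha
  change aeval 0 p = (0 : k)
  rw [aeval_zero, constantCoeff_eq, IsHomogeneous.coeff_eq_zero (n := i) hp (by simpa using hi.ne),
    map_zero]

/-- Koszulness of a tensor product over `k` of two graded algebras, in terms of a presentation. -/
lemma isKoszul_quotient_iff_of_tensorProduct {Q A B : Type u} [CommRing Q] [Algebra k Q]
    [CommRing A] [Algebra k A] [CommRing B] [Algebra k B] [Nontrivial A] [Nontrivial B]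
    {𝒬 : ℕ → Submodule k Q} [GradedAlgebra 𝒬] {𝒜 : ℕ → Submodule k A} [GradedAlgebra 𝒜]
    {ℬ : ℕ → Submodule k B} [GradedAlgebra ℬ]
    (hQ : 𝒬 0 = 1) (hA : 𝒜 0 = 1) (hB : ℬ 0 = 1) (εA : A →ₐ[k] k) (εB : B →ₐ[k] k)
    (hε : ∀ i, 0 < i → ∀ a ∈ 𝒜 i, εA a = 0) {K : Ideal Q} (hK : K.IsHomogeneous 𝒬)
    {π : Q →ₐ[k] A ⊗[k] B} (hπ : Function.Surjective π) (hker : ∀ q, π q = 0 ↔ q ∈ K)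
    (hl : ∀ j, ∀ a ∈ 𝒜 j, ∃ q ∈ 𝒬 j, π q = a ⊗ₜ 1)
    (hr : ∀ j, ∀ b ∈ ℬ j, ∃ q ∈ 𝒬 j, π q = 1 ⊗ₜ b)
    (hρ₁ : ∀ j, ∀ q ∈ 𝒬 j, Algebra.TensorProduct.lift (AlgHom.id k A)
      ((Algebra.ofId k A).comp εB) (fun _ _ => Commute.all _ _) (π q) ∈ 𝒜 j)
    (hρ₂ : ∀ j, ∀ q ∈ 𝒬 j, Algebra.TensorProduct.lift ((Algebra.ofId k B).comp εA)
      (AlgHom.id k B) (fun _ _ => Commute.all _ _) (π q) ∈ ℬ j) :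
    IsKoszul (imageGrading 𝒬 (Ideal.Quotient.mkₐ k K)) ↔ IsKoszul 𝒜 ∧ IsKoszul ℬ := by
  have e : RingHom.ker π = K := Ideal.ext hker
  rw [isKoszul_quotient_iff_of_ker (C := A ⊗[k] B) hQ hK hπ hker]
  let : GradedAlgebra (imageGrading (C := A ⊗[k] B) 𝒬 π) := imageGradedAlgebra hπ (e ▸ hK)
  refine isKoszul_tensorProduct_iff hA hB (imageGrading_zero hQ) εA εB hε hl hr ?_ ?_
  · rintro j _ ⟨q, hq, rfl⟩
    exact hρ₁ j q hq
  · rintro j _ ⟨q, hq, rfl⟩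
    exact hρ₂ j q hq

lemma isKoszul_tensorPresentation_iff
    (h₁ : I₁.IsHomogeneous (homogeneousSubmodule (Fin n) k)) (h₁' : I₁ ≠ ⊤)
    (h₂ : I₂.IsHomogeneous (homogeneousSubmodule (Fin n) k)) (h₂' : I₂ ≠ ⊤) :
    IsKoszul (imageGrading (homogeneousSubmodule (Fin n ⊕ Fin n) k)
      (Ideal.Quotient.mkₐ k (sumIdeal I₁ I₂))) ↔
      IsKoszul (gradingFromPolynomialRing k n (MvPolynomial (Fin n) k ⧸ I₁)) ∧
      IsKoszul (gradingFromPolynomialRing k n (MvPolynomial (Fin n) k ⧸ I₂)) := by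
  have : Nontrivial (MvPolynomial (Fin n) k ⧸ I₁) := Ideal.Quotient.nontrivial_iff.2 h₁'
  have : Nontrivial (MvPolynomial (Fin n) k ⧸ I₂) := Ideal.Quotient.nontrivial_iff.2 h₂'
  let := gradedAlgebraQuotient h₁
  let := gradedAlgebraQuotient h₂
  refine isKoszul_quotient_iff_of_tensorProduct (𝒬 := homogeneousSubmodule (Fin n ⊕ Fin n) k)
    (𝒜 := gradingFromPolynomialRing k n _) (ℬ := gradingFromPolynomialRing k n _)
    (homogeneousSubmodule_zero _) (imageGrading_zero (homogeneousSubmodule_zero _))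
    (imageGrading_zero (homogeneousSubmodule_zero _)) (quotientAugmentation h₁ h₁')
    (quotientAugmentation h₂ h₂') (fun i hi a ha => quotientAugmentation_eq_zero h₁ h₁' hi ha)
    (sumIdeal_isHomogeneous h₁ h₂) tensorPresentation_surjective tensorPresentation_eq_zero_iff
    ?_ ?_ ?_ ?_
  · rintro j _ ⟨p, hp, rfl⟩
    exact ⟨rename Sum.inl p, IsHomogeneous.rename_isHomogeneous hp, tensorPresentation_rename_inl p⟩
  · rintro j _ ⟨p, hp, rfl⟩
    exact ⟨rename Sum.inr p, IsHomogeneous.rename_isHomogeneous hp, tensorPresentation_rename_inr p⟩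
  · rintro j q hq
    -- Setting z = 0 lifts the retraction onto the first factor to polynomial rings, where
    -- preservation of degree is visible; the second factor uses x = 0.
    let η : MvPolynomial (Fin n ⊕ Fin n) k →ₐ[k] MvPolynomial (Fin n) k :=
      aeval (Sum.elim X fun _ => 0)
    have hη : (Algebra.TensorProduct.lift (AlgHom.id k (MvPolynomial (Fin n) k ⧸ I₁))
        ((Algebra.ofId k _).comp (quotientAugmentation h₂ h₂'))
        (fun _ _ => Commute.all _ _)).comp (tensorPresentation I₁ I₂) =
          (Ideal.Quotient.mkₐ k I₁).comp η := by
      refine MvPolynomial.algHom_ext ?_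
      rintro (i | i) <;> simp [η, tensorPresentation, quotientAugmentation]
    refine ⟨η q, ?_, (DFunLike.congr_fun hη q).symm⟩
    have : (η q).IsHomogeneous (1 * j) := IsHomogeneous.aeval hq _ (by
      rintro (i | i)
      · exact isHomogeneous_X _ _
      · exact isHomogeneous_zero _ _ _)
    rwa [one_mul] at this
  · rintro j q hq
    let η : MvPolynomial (Fin n ⊕ Fin n) k →ₐ[k] MvPolynomial (Fin n) k :=
      aeval (Sum.elim (fun _ => 0) X)
    have hη : (Algebra.TensorProduct.lift
        ((Algebra.ofId k _).comp (quotientAugmentation h₁ h₁'))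
        (AlgHom.id k (MvPolynomial (Fin n) k ⧸ I₂))
        (fun _ _ => Commute.all _ _)).comp (tensorPresentation I₁ I₂) =
          (Ideal.Quotient.mkₐ k I₂).comp η := by
      refine MvPolynomial.algHom_ext ?_
      rintro (i | i) <;> simp [η, tensorPresentation, quotientAugmentation]
    refine ⟨η q, ?_, (DFunLike.congr_fun hη q).symm⟩
    have : (η q).IsHomogeneous (1 * j) := IsHomogeneous.aeval hq _ (by
      rintro (i | i)
      · exact isHomogeneous_zero _ _ _
      · exact isHomogeneous_X _ _)
    rwa [one_mul] at this

section Quotients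

variable {R : Type*} [CommRing R] (I J : Ideal R)

lemma algebraMap_tensorProduct_quotient_surjective :
    Function.Surjective (algebraMap R ((R ⧸ I) ⊗[R] (R ⧸ J))) := by
  intro c
  induction c using TensorProduct.induction_on with
  | zero => exact ⟨0, map_zero _⟩
  | tmul a b =>
    obtain ⟨p, rfl⟩ := Ideal.Quotient.mk_surjective a
    obtain ⟨q, rfl⟩ := Ideal.Quotient.mk_surjective b
    refine ⟨q * p, ?_⟩
    have : Ideal.Quotient.mk J q = q • (1 : R ⧸ J) := by rw [Algebra.smul_def, mul_one]; rfl
    rw [this, ← TensorProduct.smul_tmul, Algebra.TensorProduct.algebraMap_apply, Algebra.smul_def,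
      map_mul]
    rfl
  | add x y hx hy =>
    obtain ⟨p, rfl⟩ := hx
    obtain ⟨q, rfl⟩ := hy
    exact ⟨p + q, map_add _ _ _⟩

lemma algebraMap_tensorProduct_quotient_eq_zero_iff (p : R) :
    algebraMap R ((R ⧸ I) ⊗[R] (R ⧸ J)) p = 0 ↔ p ∈ I ⊔ J := by
  constructor
  · intro h
    let f : (R ⧸ I) ⊗[R] (R ⧸ J) →ₐ[R] R ⧸ (I ⊔ J) :=
      Algebra.TensorProduct.lift (Ideal.Quotient.factorₐ R le_sup_left)
        (Ideal.Quotient.factorₐ R le_sup_right) (fun _ _ => Commute.all _ _)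
    have h1 := f.commutes p
    rw [h, map_zero] at h1
    exact Ideal.Quotient.eq_zero_iff_mem.1 h1.symm
  · intro h
    have : I ⊔ J ≤ RingHom.ker (algebraMap R ((R ⧸ I) ⊗[R] (R ⧸ J))) := by
      refine sup_le (fun p hp => ?_) fun p hp => ?_
      · have h0 : algebraMap R (R ⧸ I) p = 0 := Ideal.Quotient.eq_zero_iff_mem.2 hp
        rw [RingHom.mem_ker, Algebra.TensorProduct.algebraMap_apply, h0, TensorProduct.zero_tmul]
      · have h0 : algebraMap R (R ⧸ J) p = 0 := Ideal.Quotient.eq_zero_iff_mem.2 hp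
        rw [RingHom.mem_ker, ← (Algebra.TensorProduct.includeRight (R := R) (A := R ⧸ I)
          (B := R ⧸ J)).commutes p, h0, map_zero]
    exact this h

end Quotients

end Main

theorem propositionp {k : Type*} [Field k] (n : ℕ) (I₁ I₂ : Ideal (MvPolynomial (Fin n) k))
    (hI₁ : I₁.IsHomogeneous (homogeneousSubmodule (Fin n) k)) (hI₁_proper : I₁ ≠ ⊤)
    (hI₂ : I₂.IsHomogeneous (homogeneousSubmodule (Fin n) k)) (hI₂_proper : I₂ ≠ ⊤)
    (hTor : TorIndependent (MvPolynomial (Fin n) k)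
      (MvPolynomial (Fin n) k ⧸ I₁) (MvPolynomial (Fin n) k ⧸ I₂)) :
    IsKoszul (gradingFromPolynomialRing k n
        ((MvPolynomial (Fin n) k ⧸ I₁) ⊗[MvPolynomial (Fin n) k] (MvPolynomial (Fin n) k ⧸ I₂))) ↔
      IsKoszul (gradingFromPolynomialRing k n (MvPolynomial (Fin n) k ⧸ I₁)) ∧
      IsKoszul (gradingFromPolynomialRing k n (MvPolynomial (Fin n) k ⧸ I₂)) := by
  -- Both ideals consist of polynomials without constant term, so S is nonzero.
  have hsup : I₁ ⊔ I₂ ≠ ⊤ := by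
    have : I₁ ⊔ I₂ ≤ RingHom.ker (constantCoeff (σ := Fin n) (R := k)) :=
      sup_le (fun p hp => constantCoeff_eq_zero_of_mem hI₁ hI₁_proper hp)
        fun p hp => constantCoeff_eq_zero_of_mem hI₂ hI₂_proper hp
    exact fun h => RingHom.ker_ne_top _ (top_le_iff.1 (h ▸ this))
  have hnt : Nontrivial ((MvPolynomial (Fin n) k ⧸ I₁) ⊗[MvPolynomial (Fin n) k]
      (MvPolynomial (Fin n) k ⧸ I₂)) := by
    refine ⟨1, 0, fun h => hsup ((Ideal.eq_top_iff_one _).2 ?_)⟩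
    rwa [← algebraMap_tensorProduct_quotient_eq_zero_iff, map_one]
  have htop : sumIdeal I₁ I₂ ⊔ diagonalIdeal k n n ≠ ⊤ := by
    rw [Ne, Ideal.eq_top_iff_one, ← diagonalMap_mem_sup_iff, map_one, ← Ideal.eq_top_iff_one]
    exact hsup
  -- Both sides become statements about quotients of k[x, z], by J + D and by J, which differ by the
  -- diagonal forms.
  rw [← isKoszul_tensorPresentation_iff hI₁ hI₁_proper hI₂ hI₂_proper,
    ← isKoszul_gradingFromPolynomialRing_iff hI₁ hI₂ _
      (algebraMap_tensorProduct_quotient_surjective I₁ I₂)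
      (algebraMap_tensorProduct_quotient_eq_zero_iff I₁ I₂)]
  exact (isKoszul_quotient_iff_sup_span (𝒬 := homogeneousSubmodule (Fin n ⊕ Fin n) k)
    (y := diagonalForm k n) (n := n) (homogeneousSubmodule_zero _) (sumIdeal_isHomogeneous hI₁ hI₂)
    diagonalForm_mem (fun j hj => mem_diagonalIdeal_of_mul_mem hj) htop
    (sumIdeal_inf_diagonalIdeal_le (inf_le_mul_of_torIndependent hTor))).symm
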